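/- Let $d,k,l\in\mathbb{N}$, let $\Theta\subset\mathbb{R}^l$ be a nonempty compact set, let $T>0$, $1<p<\infty$, and $\mathcal{U}:=L^p([0,T],\mathbb{R}^k)$; $|\cdot|$ denotes the Euclidean norm. Let $F_0,F_1,\dots,F_k:\mathbb{R}^d\times\Theta\to\mathbb{R}^d$, $x_0:\Theta\to\mathbb{R}^d$, $a:\mathbb{R}^d\times\Theta\to[0,+\infty)$ and $f:[0,T]\times\mathbb{R}^k\to\mathbb{R}$ satisfy the following. 1. There is $L>0$ such that for all $(x_1,\theta_1),(x_2,\theta_2)\in\mathbb{R}^d\times\Theta$ $$\sup_{i=0,\dots,k}|F_i(x_1,\theta_1)-F_i(x_2,\theta_2)|\le L\big(|x_1-x_2|+|x_1+x_2|\,|\theta_1-\theta_2|\big).$$ 2. $x_0$ is continuous. 3. $a$ is continuous and nonnegative. 4. (i) $f(\cdot,v)$ is measurable for every $v\in\mathbb{R}^k$; (ii) $f(t,\cdot)$ is continuous and convex for a.e. $t\in[0,T]$; (iii) there are $c\in L^1([0,T],[0,+\infty))$ and $C>0$ such that $f(t,v)\ge C|v|^p-c(t)$ for a.e. $t\in[0,T]$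 and every $v\in\mathbb{R}^k$; (iv) there are $v'\in\mathbb{R}^k$ and $c'\in L^1([0,T],[0,+\infty))$ such that $|f(t,v')|\le c'(t)$ for a.e. $t\in[0,T]$. For $u\in\mathcal{U}$ and $\theta\in\Theta$ let $X_u(\cdot,\theta):[0,T]\to\mathbb{R}^d$ be the absolutely continuous solution of $$\dot x(t)=F_0(x(t),\theta)+\sum_{i=1}^k u_i(t)F_i(x(t),\theta)\ \text{ for a.e. } t\in[0,T],\qquad x(0)=x_0(\theta),$$ and define $$\mathcal{J}(u):=\max_{\theta\in\Theta}a(X_u(T,\theta),\theta)+\int_0^T f(t,u(t))\,dt .$$ Then $\mathcal{J}:\mathcal{U}\to\mathbb{R}\cup\{+\infty\}$ is well defined (for every $u\in\mathcal{U}$ the solution $X_u(\cdot,\theta)$ exists and is unique on $[0,T]$ for every $\theta\in\Theta$, the maximum over $\Theta$ is attained, $t\mapsto f(t,u(t))$ is measurable and its negative part is integrable on $[0,T]$), and $\mathcal{J}$ attains its minimum with a finite value: there exists $\hat u\in\mathcal{U}$ such that $$\mathcal{J}(\hat u)=\inf_{u\in\mathcal{U}}\mathcal{J}(u)\in\mathbb{R}.$$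 -/

import Mathlib

open MeasureTheory Set
open scoped ENNReal

/-- The Euclidean space `ℝⁿ`. -/
abbrev E (n : ℕ) : Type := EuclideanSpace ℝ (Fin n)

/-- The control space `L^p([0,T], ℝᵏ)`. -/
abbrev ControlSpace (T p : ℝ) (k : ℕ) : Type :=
  Lp (E k) (ENNReal.ofReal p) (volume.restrict (Icc (0 : ℝ) T))

/-- `x` is the (Carathéodory) solution on `[0,T]` of the system with parameter `θ`:
`x` is absolutely continuous on `[0,T]`, `x(0) = x₀(θ)`, and
`x'(t) = F₀(x(t),θ) + ∑ᵢ uᵢ(t) Fᵢ(x(t),θ)` for almost every `t ∈ [0,T]`. -/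
structure IsTrajectory {d k l : ℕ} {Θ : Set (E l)} (T : ℝ)
    (F₀ : E d → Θ → E d) (F : Fin k → E d → Θ → E d) (x₀ : Θ → E d)
    (u : ℝ → E k) (θ : Θ) (x : ℝ → E d) : Prop where
  absolutelyContinuous : AbsolutelyContinuousOnInterval x 0 T
  initial : x 0 = x₀ θ
  ode : ∀ᵐ t ∂(volume.restrict (Icc (0 : ℝ) T)),
    HasDerivAt x (F₀ (x t) θ + ∑ i, u t i • F i (x t) θ) t

/-- The evolution `X_u(t,θ)` of the ensemble: `X_u(·,θ)` is a solution of the Cauchy problem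
with control `u` and parameter `θ` (picked by choice; on `[0,T]` there is only one). -/
noncomputable def evolution {d k l : ℕ} {Θ : Set (E l)} (T : ℝ)
    (F₀ : E d → Θ → E d) (F : Fin k → E d → Θ → E d) (x₀ : Θ → E d)
    (u : ℝ → E k) (t : ℝ) (θ : Θ) : E d :=
  Classical.epsilon (fun x : ℝ → E d => IsTrajectory T F₀ F x₀ u θ x) t

/-- The integral over `[0,T]` with values in `[-∞,∞]`: integral of the positive part minus
integral of the negative part. -/
noncomputable def extIntegral (T : ℝ) (g : ℝ → ℝ) : EReal :=
  ((∫⁻ t in Icc (0 : ℝ) T, ENNReal.ofReal (g t) : ℝ≥0∞) : EReal) -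
    ((∫⁻ t in Icc (0 : ℝ) T, ENNReal.ofReal (-g t) : ℝ≥0∞) : EReal)

/-- The minimax functional
`J(u) = max_{θ ∈ Θ} a(X_u(T,θ),θ) + ∫₀ᵀ f(t,u(t)) dt`. -/
noncomputable def minimaxCost {d k l : ℕ} {Θ : Set (E l)} {p : ℝ} (T : ℝ)
    (F₀ : E d → Θ → E d) (F : Fin k → E d → Θ → E d) (x₀ : Θ → E d)
    (a : E d → Θ → ℝ) (f : ℝ → E k → ℝ) (u : ControlSpace T p k) : EReal :=
  (⨆ θ : Θ, ((a (evolution T F₀ F x₀ u T θ) θ : ℝ) : EReal)) +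
    extIntegral T (fun t => f t (u t))

/-! ### Linear integral estimates and Carathéodory equations: Gronwall, stability, global existence.
-/

section Caratheodory

variable {V : Type*} [NormedAddCommGroup V] [NormedSpace ℝ V]

/-! The proof is the direct method. Replacing `f` by `f + c` shifts the cost by a finite constant
and makes the running cost at least `C * ‖v‖ ^ p`, so a minimising sequence is bounded in `L^p` with
`p > 1`.

Weak compactness takes a concrete form in `exists_subseq_weak_limit`: along a subsequence the
primitives of the controls converge uniformly (Arzelà–Ascoli), and convex combinations of the tails
converge almost everywhere to some `w` in `L^p` (Komlós). The `L^p` bound upgrades the latter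
convergence to `L^1`, which identifies the uniform limit as the primitive of `w`.

Each kind of convergence serves one term of the cost. The system is affine in the control, so along
the limit trajectory the perturbation is a sum of terms `(u_n - w)_i F_i`. Each `F_i` is absolutely
continuous there, so integration by parts bounds the integral by the primitive of `u_n - w`, and
Gronwall gives convergence of the end points (`IsLipschitzFamily.tendsto_evolution`). For the
running cost, sublevel sets are convex and Fatou's lemma applies to the convex combinations. The
supremum over `θ` needs no uniform convergence, being lower semicontinuous; compactness of `Θ`
enters through attainment of the maximum. -/

theorem AbsolutelyContinuousOnInterval.of_dist_le {X Y : Type*} [PseudoMetricSpace X]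
    [PseudoMetricSpace Y] {f : ℝ → X} {g : ℝ → Y} {a b C : ℝ}
    (hg : AbsolutelyContinuousOnInterval g a b)
    (hfg : ∀ s ∈ uIcc a b, ∀ t ∈ uIcc a b, dist (f s) (f t) ≤ C * dist (g s) (g t)) :
    AbsolutelyContinuousOnInterval f a b := by
  rw [absolutelyContinuousOnInterval_iff] at hg ⊢
  intro ε hε
  obtain ⟨δ, hδ, h⟩ := hg (ε / (|C| + 1)) (by positivity)
  refine ⟨δ, hδ, fun I hI hlen => ?_⟩
  calc ∑ i ∈ Finset.range I.1, dist (f (I.2 i).1) (f (I.2 i).2)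
      ≤ ∑ i ∈ Finset.range I.1, (|C| + 1) * dist (g (I.2 i).1) (g (I.2 i).2) := by
        refine Finset.sum_le_sum fun i hi => (hfg _ (hI.1 i hi).1 _ (hI.1 i hi).2).trans ?_
        exact mul_le_mul_of_nonneg_right (by linarith [le_abs_self C]) dist_nonneg
    _ = (|C| + 1) * ∑ i ∈ Finset.range I.1, dist (g (I.2 i).1) (g (I.2 i).2) := by
        rw [Finset.mul_sum]
    _ < (|C| + 1) * (ε / (|C| + 1)) :=
        mul_lt_mul_of_pos_left (h I hI hlen) (by positivity)
    _ = ε := by field_simp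

theorem LipschitzWith.comp_absolutelyContinuousOnInterval {X Y : Type*} [PseudoMetricSpace X]
    [PseudoMetricSpace Y] {f : X → Y} {g : ℝ → X} {a b : ℝ} {K : NNReal}
    (hf : LipschitzWith K f) (hg : AbsolutelyContinuousOnInterval g a b) :
    AbsolutelyContinuousOnInterval (fun t => f (g t)) a b :=
  hg.of_dist_le fun _ _ _ _ => hf.dist_le_mul _ _

/-- Increments of the primitive of `f` are dominated by those of the primitive of `‖f‖`, which
reduces the claim to a real-valued integrand. -/
theorem IntervalIntegrable.absolutelyContinuousOnInterval_integral {f : ℝ → V} {a b : ℝ}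
    (hf : IntervalIntegrable f volume a b) :
    AbsolutelyContinuousOnInterval (fun t => ∫ s in a..t, f s) a b := by
  refine (hf.norm.absolutelyContinuousOnInterval_intervalIntegral
    (c := a) left_mem_uIcc).of_dist_le (C := 1) fun s hs t ht => ?_
  have hi : ∀ {c}, c ∈ uIcc a b → IntervalIntegrable f volume a c := fun hc =>
    hf.mono_set (uIcc_subset_uIcc_left hc)
  rw [one_mul, dist_comm, dist_comm (∫ v in a..s, ‖f v‖), dist_eq_norm, Real.dist_eq,
    intervalIntegral.integral_interval_sub_left (hi ht) (hi hs),
    intervalIntegral.integral_interval_sub_left (hi ht).norm (hi hs).norm]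
  exact intervalIntegral.norm_integral_le_abs_integral_norm

/-- Fundamental theorem of calculus for vector-valued absolutely continuous functions. -/
theorem AbsolutelyContinuousOnInterval.eq_add_integral [CompleteSpace V] {x x' : ℝ → V} {a b : ℝ}
    (hx : AbsolutelyContinuousOnInterval x a b) (hx' : IntervalIntegrable x' volume a b)
    (hd : ∀ᵐ t, t ∈ uIcc a b → HasDerivAt x (x' t) t) :
    ∀ t ∈ uIcc a b, x t = x a + ∫ s in a..t, x' s := by
  have hac : AbsolutelyContinuousOnInterval (fun t => x t - ∫ s in a..t, x' s) a b :=
    hx.sub hx'.absolutelyContinuousOnInterval_integral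
  obtain ⟨C, hC⟩ := hac.const_of_ae_hasDerivAt_zero (by
    filter_upwards [hd, hx'.ae_hasDerivAt_integral] with t h1 h2 ht
    simpa using (h1 ht).fun_sub (h2 ht a left_mem_uIcc))
  intro t ht
  have h1 := hC t ht
  have h2 := hC a left_mem_uIcc
  simp only [intervalIntegral.integral_same, sub_zero] at h2
  rw [h2, ← h1]
  abel

variable {T : ℝ}

theorem integral_nonneg_mono_of_nonneg {m : ℝ → ℝ} (hm : IntervalIntegrable m volume 0 T)
    (hm0 : ∀ s, 0 ≤ m s) {t : ℝ} (ht : t ∈ Icc 0 T) :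
    0 ≤ ∫ s in 0..t, m s ∧ ∫ s in 0..t, m s ≤ ∫ s in 0..T, m s := by
  refine ⟨intervalIntegral.integral_nonneg ht.1 fun s _ => hm0 s, ?_⟩
  exact intervalIntegral.integral_mono_interval le_rfl ht.1 ht.2
    (Filter.Eventually.of_forall hm0) hm

theorem IntervalIntegrable.mono_right_mem {W : Type*} [NormedAddCommGroup W] {f : ℝ → W}
    (hf : IntervalIntegrable f volume 0 T) {t : ℝ}
    (ht : t ∈ Icc 0 T) : IntervalIntegrable f volume 0 t :=
  hf.mono_set (uIcc_subset_uIcc_left (by rwa [uIcc_of_le (ht.1.trans ht.2)]))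

theorem IntervalIntegrable.continuousOn_integral {f : ℝ → V} (hT : 0 ≤ T)
    (hf : IntervalIntegrable f volume 0 T) :
    ContinuousOn (fun t => ∫ s in 0..t, f s) (Icc 0 T) := by
  have := hf.absolutelyContinuousOnInterval_integral.continuousOn
  rwa [uIcc_of_le hT] at this

/-- Change of variables along the primitive of an integrable function. -/
theorem integral_mul_deriv_comp_integral {m g g' : ℝ → ℝ}
    (hm : IntervalIntegrable m volume 0 T) (hg : ∀ r, HasDerivAt g (g' r) r)
    (hg' : Continuous g') {t : ℝ} (ht : t ∈ Icc 0 T) :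
    IntervalIntegrable (fun s => m s * g' (∫ r in 0..s, m r)) volume 0 t ∧
    ∫ s in 0..t, m s * g' (∫ r in 0..s, m r) = g (∫ r in 0..t, m r) - g 0 := by
  have hmt := hm.mono_right_mem ht
  have hM := hmt.absolutelyContinuousOnInterval_integral
  have hMc := hM.continuousOn
  have hint : IntervalIntegrable (fun s => m s * g' (∫ r in 0..s, m r)) volume 0 t :=
    hmt.mul_continuousOn (hg'.comp_continuousOn hMc)
  refine ⟨hint, ?_⟩
  -- The primitive stays in a compact interval, where the `C¹` function `g` is Lipschitz; hence the
  -- composite is absolutely continuous.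
  obtain ⟨B, hB⟩ := hM.exists_bound
  have hgC : ContDiff ℝ 1 g := by
    rw [contDiff_one_iff_deriv]
    refine ⟨fun r => (hg r).differentiableAt, ?_⟩
    convert! hg' using 1
    exact funext fun r => (hg r).deriv
  obtain ⟨K, hK⟩ := hgC.contDiffOn.exists_lipschitzOnWith (s := Icc (-B) B) (by decide)
    (convex_Icc _ _) isCompact_Icc
  have hmem : ∀ s ∈ uIcc 0 t, ∫ r in 0..s, m r ∈ Icc (-B) B := fun s hs => abs_le.1 (hB s hs)
  have hac : AbsolutelyContinuousOnInterval (fun s => g (∫ r in 0..s, m r)) 0 t :=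
    hM.of_dist_le fun s hs s' hs' => hK.dist_le_mul _ (hmem s hs) _ (hmem s' hs')
  have := hac.eq_add_integral hint (by
    filter_upwards [hmt.ae_hasDerivAt_integral] with s h1 hs
    rw [mul_comm]
    exact (hg _).comp s (h1 hs 0 left_mem_uIcc)) t right_mem_uIcc
  simp only [intervalIntegral.integral_same] at this
  rw [this]
  ring

/-- **Gronwall's inequality** with an integrable kernel. -/
theorem le_mul_exp_integral_of_le_add_integral {m φ : ℝ → ℝ} {A : ℝ} (hT : 0 ≤ T)
    (hm : IntervalIntegrable m volume 0 T) (hm0 : ∀ s, 0 ≤ m s) (hφ : ContinuousOn φ (Icc 0 T))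
    (h : ∀ t ∈ Icc 0 T, φ t ≤ A + ∫ s in 0..t, m s * φ s) :
    ∀ t ∈ Icc 0 T, φ t ≤ A * Real.exp (∫ s in 0..t, m s) := by
  -- Let `B` be the maximum of this function, attained at `τ`. Inserting `φ ≤ B * exp (∫ m)` into
  -- the hypothesis at `τ` gives `B * exp (∫ m) ≤ A + B * exp (∫ m) - B`, that is, `B ≤ A`.
  have hcont : ContinuousOn (fun t => φ t * Real.exp (-∫ s in 0..t, m s)) (Icc 0 T) :=
    hφ.mul (Real.continuous_exp.comp_continuousOn (hm.continuousOn_integral hT).neg)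
  obtain ⟨τ, hτ, hmax⟩ := isCompact_Icc.exists_isMaxOn (nonempty_Icc.2 hT) hcont
  set B := φ τ * Real.exp (-∫ s in 0..τ, m s) with hB
  have hle : ∀ t ∈ Icc 0 T, φ t ≤ B * Real.exp (∫ s in 0..t, m s) := by
    intro t ht
    have h1 : φ t * Real.exp (-∫ s in 0..t, m s) ≤ B := hmax ht
    calc φ t = φ t * Real.exp (-∫ s in 0..t, m s) * Real.exp (∫ s in 0..t, m s) := by
          rw [mul_assoc, ← Real.exp_add]; simp
      _ ≤ _ := mul_le_mul_of_nonneg_right h1 (Real.exp_pos _).le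
  have hBA : B ≤ A := by
    obtain ⟨hi, he⟩ := integral_mul_deriv_comp_integral (g := fun r => B * Real.exp r)
      (g' := fun r => B * Real.exp r) hm (fun r => (Real.hasDerivAt_exp r).const_mul B)
      (by fun_prop) hτ
    have h1 : ∫ s in 0..τ, m s * φ s ≤
        ∫ s in 0..τ, m s * (B * Real.exp (∫ r in 0..s, m r)) := by
      refine intervalIntegral.integral_mono_on hτ.1 ?_ hi fun s hs =>
        mul_le_mul_of_nonneg_left (hle s ⟨hs.1, hs.2.trans hτ.2⟩) (hm0 s)
      refine (hm.mono_right_mem hτ).mul_continuousOn (hφ.mono ?_)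
      rw [uIcc_of_le hτ.1]
      exact Icc_subset_Icc_right hτ.2
    have h2 := h τ hτ
    have h3 : φ τ = B * Real.exp (∫ s in 0..τ, m s) := by
      rw [hB, mul_assoc, ← Real.exp_add]; simp
    rw [he] at h1
    simp only [Real.exp_zero, mul_one] at h1
    linarith
  exact fun t ht => (hle t ht).trans (mul_le_mul_of_nonneg_right hBA (Real.exp_pos _).le)

/-- Stability of solutions of integral equations under perturbations. -/
theorem norm_sub_le_of_integral_eq {m : ℝ → ℝ} {h h' : ℝ → V → V} {x y : ℝ → V} {x₀ y₀ : V}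
    {A : ℝ} (hT : 0 ≤ T) (hm : IntervalIntegrable m volume 0 T) (hm0 : ∀ s, 0 ≤ m s)
    (hlip : ∀ s v w, ‖h s v - h s w‖ ≤ m s * ‖v - w‖)
    (hint : ∀ z, ContinuousOn z (Icc 0 T) → IntervalIntegrable (fun s => h s (z s)) volume 0 T)
    (hint' : IntervalIntegrable (fun s => h' s (y s)) volume 0 T)
    (hxc : ContinuousOn x (Icc 0 T)) (hyc : ContinuousOn y (Icc 0 T))
    (hx : ∀ t ∈ Icc 0 T, x t = x₀ + ∫ s in 0..t, h s (x s))
    (hy : ∀ t ∈ Icc 0 T, y t = y₀ + ∫ s in 0..t, h' s (y s))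
    (hA : ∀ t ∈ Icc 0 T, ‖x₀ - y₀ + ∫ s in 0..t, (h s (y s) - h' s (y s))‖ ≤ A) :
    ∀ t ∈ Icc 0 T, ‖x t - y t‖ ≤ A * Real.exp (∫ s in 0..t, m s) := by
  refine le_mul_exp_integral_of_le_add_integral hT hm hm0 (hxc.sub hyc).norm fun t ht => ?_
  have ix := (hint x hxc).mono_right_mem ht
  have iy := (hint y hyc).mono_right_mem ht
  have iy' := hint'.mono_right_mem ht
  have e : x t - y t = (∫ s in 0..t, (h s (x s) - h s (y s))) +
      (x₀ - y₀ + ∫ s in 0..t, (h s (y s) - h' s (y s))) := by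
    rw [hx t ht, hy t ht, intervalIntegral.integral_sub ix iy, intervalIntegral.integral_sub iy iy']
    abel
  rw [e, add_comm A]
  refine (norm_add_le _ _).trans (add_le_add ?_ (hA t ht))
  refine intervalIntegral.norm_integral_le_of_norm_le ht.1
    (Filter.Eventually.of_forall fun s _ => hlip s _ _) ?_
  refine (hm.mono_right_mem ht).mul_continuousOn ((hxc.sub hyc).norm.mono ?_)
  rw [uIcc_of_le ht.1]
  exact Icc_subset_Icc_right ht.2

/-- Global existence for the integral equation with an integrable Lipschitz constant. -/
theorem exists_continuousOn_eq_add_integral [CompleteSpace V] {m : ℝ → ℝ} {h : ℝ → V → V}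
    (hT : 0 ≤ T) (hm : IntervalIntegrable m volume 0 T) (hm0 : ∀ s, 0 ≤ m s)
    (hlip : ∀ s v w, ‖h s v - h s w‖ ≤ m s * ‖v - w‖)
    (hint : ∀ z, ContinuousOn z (Icc 0 T) → IntervalIntegrable (fun s => h s (z s)) volume 0 T)
    (x₀ : V) :
    ∃ x : ℝ → V, ContinuousOn x (Icc 0 T) ∧
      ∀ t ∈ Icc 0 T, x t = x₀ + ∫ s in 0..t, h s (x s) := by
  have hext : ∀ z : C(Icc 0 T, V), Continuous (IccExtend hT z) := fun z => z.continuous.Icc_extend'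
  have hi : ∀ z : C(Icc 0 T, V), IntervalIntegrable (fun s => h s (IccExtend hT z s)) volume 0 T :=
    fun z => hint _ (hext z).continuousOn
  let Φ : C(Icc 0 T, V) → C(Icc 0 T, V) := fun z =>
    ⟨fun t => x₀ + ∫ s in 0..t, h s (IccExtend hT z s),
      continuous_const.add (continuousOn_iff_continuous_domRestrict.1
        ((hi z).continuousOn_integral hT))⟩
  -- The factorial gained by iterating the Picard map makes some iterate a contraction on all of
  -- `[0,T]`, so no gluing of local solutions is needed.
  have key : ∀ (n : ℕ) (y z : C(Icc 0 T, V)) (t : Icc 0 T), ‖(Φ^[n] y) t - (Φ^[n] z) t‖ ≤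
      dist y z * ((∫ s in 0..(t : ℝ), m s) ^ n / n.factorial) := by
    intro n y z
    induction n with
    | zero =>
      intro t
      simpa [dist_eq_norm] using (y - z).norm_coe_le_norm t
    | succ n ih =>
      intro t
      have ht := t.2
      obtain ⟨hii, he⟩ := integral_mul_deriv_comp_integral
        (g := fun r => dist y z * (r ^ (n + 1) / (n + 1).factorial))
        (g' := fun r => dist y z * (r ^ n / n.factorial)) hm (fun r => by
          refine HasDerivAt.const_mul _ ?_
          have := ((hasDerivAt_pow (n + 1) r).div_const ((n + 1).factorial : ℝ))
          convert! this using 1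
          rw [Nat.factorial_succ]
          push_cast
          have : (n.factorial : ℝ) ≠ 0 := by positivity
          have : (n : ℝ) + 1 ≠ 0 := by positivity
          field_simp)
        (by fun_prop) ht
      rw [Function.iterate_succ_apply', Function.iterate_succ_apply']
      have e : Φ (Φ^[n] y) t - Φ (Φ^[n] z) t = ∫ s in 0..(t : ℝ),
          (h s (IccExtend hT (Φ^[n] y) s) - h s (IccExtend hT (Φ^[n] z) s)) := by
        rw [intervalIntegral.integral_sub ((hi _).mono_right_mem ht) ((hi _).mono_right_mem ht)]
        simp [Φ]
      rw [e]
      calc _ ≤ ∫ s in 0..(t : ℝ),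
            m s * (dist y z * ((∫ r in 0..s, m r) ^ n / n.factorial)) := by
            refine intervalIntegral.norm_integral_le_of_norm_le ht.1
              (Filter.Eventually.of_forall fun s hs => (hlip s _ _).trans ?_) hii
            have hs' : s ∈ Icc 0 T := ⟨hs.1.le, hs.2.trans ht.2⟩
            refine mul_le_mul_of_nonneg_left ?_ (hm0 s)
            rw [IccExtend_of_mem _ _ hs', IccExtend_of_mem _ _ hs']
            exact ih ⟨s, hs'⟩
        _ = _ := by rw [he]; simp
  set M := ∫ s in 0..T, m s with hM
  obtain ⟨n, hn⟩ : ∃ n : ℕ, M ^ n / n.factorial < 1 / 2 :=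
    ((FloorSemiring.tendsto_pow_div_factorial_atTop M).eventually
      (gt_mem_nhds (by norm_num))).exists
  have hM0 : 0 ≤ M := intervalIntegral.integral_nonneg hT fun s _ => hm0 s
  have hcon : ContractingWith (1 / 2) Φ^[n] := by
    refine ⟨by norm_num, LipschitzWith.of_dist_le_mul fun y z => ?_⟩
    rw [ContinuousMap.dist_le (by positivity)]
    intro t
    rw [dist_eq_norm]
    refine (key n y z t).trans ?_
    rw [mul_comm]
    refine mul_le_mul_of_nonneg_right ?_ dist_nonneg
    obtain ⟨h1, h2⟩ := integral_nonneg_mono_of_nonneg hm hm0 t.2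
    refine le_trans ?_ (by simpa using hn.le)
    gcongr
  have hfix := hcon.isFixedPt_fixedPoint_iterate
  set x := ContractingWith.fixedPoint Φ^[n] hcon
  refine ⟨IccExtend hT x, (hext x).continuousOn, fun t ht => ?_⟩
  rw [IccExtend_of_mem _ _ ht]
  conv_lhs => rw [← hfix]
  rfl

end Caratheodory

/-! ### Almost everywhere convergent convex combinations of an `L^1`-bounded sequence. -/

section Komlos

open Filter Topology

variable {V : Type*} [NormedAddCommGroup V] [InnerProductSpace ℝ V]

/-- A quantitative form of the strict convexity of `x ↦ √(1 + ‖x‖²)`. -/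
theorem norm_sub_sq_le_sqrt_defect (x y : V) :
    ‖x - y‖ ^ 2 ≤ (√(1 + ‖x‖ ^ 2) + √(1 + ‖y‖ ^ 2) - 2 * √(1 + ‖(1 / 2 : ℝ) • (x + y)‖ ^ 2)) *
      (√(1 + ‖x‖ ^ 2) + √(1 + ‖y‖ ^ 2)) ^ 3 ∧
    0 ≤ √(1 + ‖x‖ ^ 2) + √(1 + ‖y‖ ^ 2) - 2 * √(1 + ‖(1 / 2 : ℝ) • (x + y)‖ ^ 2) := by
  have hc := abs_real_inner_le_norm x y
  have hxy : ‖x - y‖ ^ 2 = ‖x‖ ^ 2 + ‖y‖ ^ 2 - 2 * inner ℝ x y := by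
    rw [norm_sub_sq_real]; ring
  have hmid : ‖(1 / 2 : ℝ) • (x + y)‖ ^ 2 = (‖x‖ ^ 2 + ‖y‖ ^ 2 + 2 * inner ℝ x y) / 4 := by
    rw [norm_smul, mul_pow, norm_add_sq_real, Real.norm_of_nonneg (by norm_num)]; ring
  rw [hxy, hmid]
  set c : ℝ := inner ℝ x y
  set a := ‖x‖
  set b := ‖y‖
  have ha : 0 ≤ a := norm_nonneg x
  have hb : 0 ≤ b := norm_nonneg y
  have hab : a ^ 2 + b ^ 2 - 2 * c ≥ 0 := by nlinarith [sq_nonneg (a - b), (abs_le.1 hc).2]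
  have hcs : c ^ 2 ≤ a ^ 2 * b ^ 2 := by
    rw [← mul_pow, ← sq_abs c]; exact pow_le_pow_left₀ (abs_nonneg c) hc 2
  have hQ : 0 ≤ 1 + (a ^ 2 + b ^ 2 + 2 * c) / 4 := by
    nlinarith [sq_nonneg (a - b), (abs_le.1 hc).1]
  have hX2 := Real.sq_sqrt (show (0 : ℝ) ≤ 1 + a ^ 2 by positivity)
  have hY2 := Real.sq_sqrt (show (0 : ℝ) ≤ 1 + b ^ 2 by positivity)
  have hZ2 := Real.sq_sqrt hQ
  have hX : 0 < √(1 + a ^ 2) := by positivity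
  have hY : 0 < √(1 + b ^ 2) := by positivity
  have hZ : 0 ≤ √(1 + (a ^ 2 + b ^ 2 + 2 * c) / 4) := Real.sqrt_nonneg _
  set X := √(1 + a ^ 2)
  set Y := √(1 + b ^ 2)
  set Z := √(1 + (a ^ 2 + b ^ 2 + 2 * c) / 4)
  -- The quantity `X * Y - (1 + c)`, the Cauchy–Schwarz gap of `(1, x)` and `(1, y)`, links the two
  -- sides: it is at most the defect times `X + Y`, and its product with `(X + Y) ^ 2` dominates `‖x
  -- - y‖ ^ 2`.
  have hprod : (X * Y) ^ 2 - (1 + c) ^ 2 ≥ a ^ 2 + b ^ 2 - 2 * c := by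
    rw [mul_pow, hX2, hY2]; nlinarith
  have hP : |1 + c| ≤ X * Y := abs_le_of_sq_le_sq (by linarith) (by positivity)
  have hP' := abs_le.1 hP
  have hdiff : (X + Y - 2 * Z) * (X + Y + 2 * Z) = 2 * (X * Y - (1 + c)) := by nlinarith
  have hZle : 2 * Z ≤ X + Y := abs_le_of_sq_le_sq' (by nlinarith) (by positivity) |>.2
  refine ⟨?_, by linarith⟩
  have h1 : X * Y - (1 + c) ≤ (X + Y - 2 * Z) * (X + Y) := by
    nlinarith [mul_nonneg (sub_nonneg.2 hZle) (sub_nonneg.2 hZle)]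
  have h2 : a ^ 2 + b ^ 2 - 2 * c ≤ (X * Y - (1 + c)) * (X + Y) ^ 2 := by
    have h3 : X * Y + (1 + c) ≤ (X + Y) ^ 2 := by nlinarith
    calc a ^ 2 + b ^ 2 - 2 * c ≤ (X * Y - (1 + c)) * (X * Y + (1 + c)) := by linarith
      _ ≤ _ := mul_le_mul_of_nonneg_left h3 (by linarith)
  calc _ ≤ (X * Y - (1 + c)) * (X + Y) ^ 2 := h2
    _ ≤ (X + Y - 2 * Z) * (X + Y) * (X + Y) ^ 2 := mul_le_mul_of_nonneg_right h1 (by positivity)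
    _ = _ := by ring

/-- Rescaling `D * s ^ 3 = (D / ε ^ 3) * (ε * s) ^ 3` and bounding both factors by their sum gives a
fourth power. The bracket on the right is linear in the defect and in `s`, so its integral is
controlled by integrals of `√(1 + ‖·‖²)` alone. -/
theorem norm_sub_le_sq_sqrt_defect (x y : V) {ε : ℝ} (hε : 0 < ε) :
    ‖x - y‖ ≤ ((√(1 + ‖x‖ ^ 2) + √(1 + ‖y‖ ^ 2) -
      2 * √(1 + ‖(1 / 2 : ℝ) • (x + y)‖ ^ 2)) / ε ^ 3 +
      ε * (√(1 + ‖x‖ ^ 2) + √(1 + ‖y‖ ^ 2))) ^ 2 := by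
  obtain ⟨h1, h2⟩ := norm_sub_sq_le_sqrt_defect x y
  have hs : 0 ≤ √(1 + ‖x‖ ^ 2) + √(1 + ‖y‖ ^ 2) := by positivity
  set s := √(1 + ‖x‖ ^ 2) + √(1 + ‖y‖ ^ 2)
  set D := s - 2 * √(1 + ‖(1 / 2 : ℝ) • (x + y)‖ ^ 2)
  refine le_of_sq_le_sq ?_ (by positivity)
  refine h1.trans ?_
  have hD : 0 ≤ D / ε ^ 3 := by positivity
  have hE : 0 ≤ ε * s := by positivity
  have e : D * s ^ 3 = (D / ε ^ 3) * (ε * s) ^ 3 := by field_simp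
  rw [e]
  set P := D / ε ^ 3
  set Q := ε * s
  calc P * Q ^ 3 ≤ (P + Q) * (P + Q) ^ 3 := by gcongr <;> linarith
    _ = _ := by ring

variable {Ω : Type*} [MeasurableSpace Ω] {μ : Measure Ω}

theorem ae_summable_of_summable_integral {g : ℕ → Ω → ℝ} (hg : ∀ n, Integrable (g n) μ)
    (hg0 : ∀ n x, 0 ≤ g n x) {b : ℕ → ℝ} (hb : Summable b) (h : ∀ n, ∫ x, g n x ∂μ ≤ b n) :
    ∀ᵐ x ∂μ, Summable fun n => g n x := by
  have hlt : ∫⁻ x, ∑' n, ENNReal.ofReal (g n x) ∂μ ≠ ⊤ := by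
    rw [lintegral_tsum fun n => (hg n).1.aemeasurable.ennreal_ofReal]
    refine ne_top_of_le_ne_top hb.tsum_ofReal_ne_top (ENNReal.tsum_le_tsum fun n => ?_)
    rw [← ofReal_integral_eq_lintegral_ofReal (hg n) (Eventually.of_forall (hg0 n))]
    exact ENNReal.ofReal_le_ofReal (h n)
  filter_upwards [ae_lt_top' (AEMeasurable.tsum fun n =>
    (hg n).1.aemeasurable.ennreal_ofReal) hlt] with x hx
  refine (ENNReal.summable_toReal hx.ne).congr fun n => ?_
  exact ENNReal.toReal_ofReal (hg0 n x)

/-- **Komlós-type lemma**: a sequence bounded in `L¹` has forward convex combinations that converge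
almost everywhere. -/
theorem exists_mem_convexHull_tendsto_ae [IsFiniteMeasure μ] [CompleteSpace V] {u : ℕ → Ω → V}
    (hu : ∀ n, Integrable (u n) μ) {K : ℝ} (hK : ∀ n, ∫ x, ‖u n x‖ ∂μ ≤ K) :
    ∃ (v : ℕ → Ω → V) (w : Ω → V), (∀ n, v n ∈ convexHull ℝ (u '' Ici n)) ∧
      ∀ᵐ x ∂μ, Tendsto (fun n => v n x) atTop (𝓝 (w x)) := by
  set A : ℕ → Set (Ω → V) := fun n => convexHull ℝ (u '' Ici n)
  have hAmono : ∀ {i j}, i ≤ j → A j ⊆ A i := fun hij =>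
    convexHull_mono (image_mono (Ici_subset_Ici.2 hij))
  set S : Set (Ω → V) := {v | Integrable v μ ∧ ∫ x, ‖v x‖ ∂μ ≤ K}
  have hAS : ∀ n, A n ⊆ S := by
    intro n
    refine convexHull_min ?_ ?_
    · rintro _ ⟨j, -, rfl⟩
      exact ⟨hu j, hK j⟩
    · intro v hv w hw a b ha hb hab
      have hi : Integrable (a • v + b • w) μ := (hv.1.smul a).add (hw.1.smul b)
      refine ⟨hi, ?_⟩
      calc ∫ x, ‖(a • v + b • w) x‖ ∂μ ≤ ∫ x, (a * ‖v x‖ + b * ‖w x‖) ∂μ := by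
            refine integral_mono hi.norm ((hv.1.norm.const_mul a).add (hw.1.norm.const_mul b))
              fun x => ?_
            refine (norm_add_le _ _).trans_eq ?_
            simp [norm_smul, abs_of_nonneg ha, abs_of_nonneg hb]
        _ = a * ∫ x, ‖v x‖ ∂μ + b * ∫ x, ‖w x‖ ∂μ := by
            rw [integral_add (hv.1.norm.const_mul a) (hw.1.norm.const_mul b),
              integral_const_mul, integral_const_mul]
        _ ≤ a * K + b * K := by
            gcongr
            exacts [hv.2, hw.2]
        _ = K := by rw [← add_mul, hab, one_mul]
  -- `ψ` plays the role of the squared norm in the Hilbert space argument: it is strictly convex,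
  -- but of linear growth, so `L^1` functions suffice.
  set ψ : V → ℝ := fun x => √(1 + ‖x‖ ^ 2)
  have hψle : ∀ x, ψ x ≤ 1 + ‖x‖ := fun x =>
    Real.sqrt_le_iff.2 ⟨by positivity, by nlinarith [norm_nonneg x]⟩
  have hψ0 : ∀ x, 0 ≤ ψ x := fun x => Real.sqrt_nonneg _
  have hψc : Continuous ψ := by fun_prop
  have hψi : ∀ {v : Ω → V}, Integrable v μ → Integrable (fun x => ψ (v x)) μ := fun {v} hv =>
    ((integrable_const (1 : ℝ)).add hv.norm).mono' (hψc.comp_aestronglyMeasurable hv.1)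
      (Eventually.of_forall fun x => by
        rw [Real.norm_of_nonneg (hψ0 _)]; exact hψle _)
  set Ψ : (Ω → V) → ℝ := fun v => ∫ x, ψ (v x) ∂μ
  set B := μ.real univ + K
  have hΨB : ∀ v ∈ S, Ψ v ≤ B := by
    intro v hv
    calc Ψ v ≤ ∫ x, (1 + ‖v x‖) ∂μ :=
          integral_mono (hψi hv.1) ((integrable_const (1 : ℝ)).add hv.1.norm) fun x => hψle _
      _ = μ.real univ + ∫ x, ‖v x‖ ∂μ := by
          rw [integral_add (integrable_const _) hv.1.norm]; simp
      _ ≤ B := by simpa [B] using hv.2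
  have hΨ0 : ∀ v, 0 ≤ Ψ v := fun v => integral_nonneg fun x => hψ0 _
  have hAne : ∀ n, u n ∈ A n := fun n => subset_convexHull _ _ ⟨n, mem_Ici.2 le_rfl, rfl⟩
  set I : ℕ → ℝ := fun n => sInf (Ψ '' A n)
  have hbdd : ∀ n, BddBelow (Ψ '' A n) := fun n => ⟨0, by rintro _ ⟨v, -, rfl⟩; exact hΨ0 v⟩
  have hIle : ∀ n, ∀ v ∈ A n, I n ≤ Ψ v := fun n v hv => csInf_le (hbdd n) ⟨v, hv, rfl⟩
  have hImono : Monotone I := fun i j hij =>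
    csInf_le_csInf (hbdd i) ⟨_, _, hAne j, rfl⟩ (image_mono (hAmono hij))
  have hIB : BddAbove (range I) :=
    ⟨B, by rintro _ ⟨n, rfl⟩; exact (hIle n _ (hAne n)).trans (hΨB _ (hAS n (hAne n)))⟩
  have hIlim := tendsto_atTop_ciSup hImono hIB
  set J := ⨆ n, I n
  have hIJ : ∀ n, I n ≤ J := le_ciSup hIB
  -- Near-minimisers `v j`, `v (j + 1)` have their midpoint in the same hull, so the integrated
  -- defect is at most `4 * (1/16) ^ j`. Dividing by `ε ^ 3` with `ε = (1/2) ^ j` leaves `4 * (1/2)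
  -- ^ j`, which is summable.
  obtain ⟨φ, hφ, hφI⟩ := extraction_forall_of_eventually
    (P := fun j n => J - (1 / 16) ^ j < I n)
    fun j => hIlim.eventually (lt_mem_nhds (by simp))
  have hex : ∀ j, ∃ v ∈ A (φ j), Ψ v < J + (1 / 16) ^ j := by
    intro j
    obtain ⟨_, ⟨v, hv, rfl⟩, hlt⟩ := exists_lt_of_csInf_lt (s := Ψ '' A (φ j))
      (b := J + (1 / 16) ^ j) ⟨_, _, hAne _, rfl⟩
      (lt_of_le_of_lt (hIJ (φ j)) (by simp))
    exact ⟨v, hv, hlt⟩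
  choose v hvA hvΨ using hex
  have hvi : ∀ j, Integrable (v j) μ := fun j => (hAS _ (hvA j)).1
  set g : ℕ → Ω → ℝ := fun j x => (ψ (v j x) + ψ (v (j + 1) x) -
      2 * ψ ((1 / 2 : ℝ) • (v j x + v (j + 1) x))) / ((1 / 2) ^ j) ^ 3 +
      (1 / 2) ^ j * (ψ (v j x) + ψ (v (j + 1) x)) with hg
  have hmi : ∀ j, Integrable (fun x => (1 / 2 : ℝ) • (v j x + v (j + 1) x)) μ := fun j =>
    ((hvi j).add (hvi (j + 1))).smul (1 / 2 : ℝ)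
  have his : ∀ j, Integrable (fun x => ψ (v j x) + ψ (v (j + 1) x)) μ := fun j =>
    (hψi (hvi j)).add (hψi (hvi (j + 1)))
  have hiD : ∀ j, Integrable (fun x => ψ (v j x) + ψ (v (j + 1) x) -
      2 * ψ ((1 / 2 : ℝ) • (v j x + v (j + 1) x))) μ := fun j =>
    (his j).sub ((hψi (hmi j)).const_mul 2)
  have hgi : ∀ j, Integrable (g j) μ := fun j =>
    ((hiD j).div_const _).add ((his j).const_mul _)
  have hg0 : ∀ j x, 0 ≤ g j x := by
    intro j x
    have := (norm_sub_sq_le_sqrt_defect (v j x) (v (j + 1) x)).2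
    have h1 := hψ0 (v j x)
    have h2 := hψ0 (v (j + 1) x)
    have : 0 ≤ ψ (v j x) + ψ (v (j + 1) x) - 2 * ψ ((1 / 2 : ℝ) • (v j x + v (j + 1) x)) := this
    simp only [hg]
    positivity
  have hgint : ∀ j, ∫ x, g j x ∂μ ≤ (4 + 2 * B) * (1 / 2) ^ j := by
    intro j
    have hmid : (fun x => (1 / 2 : ℝ) • (v j x + v (j + 1) x)) ∈ A (φ j) := by
      have := convex_convexHull ℝ (u '' Ici (φ j)) (hvA j)
        (hAmono (hφ.monotone (Nat.le_succ j)) (hvA (j + 1)))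
        (show (0 : ℝ) ≤ 1 / 2 by norm_num) (show (0 : ℝ) ≤ 1 / 2 by norm_num) (by norm_num)
      convert! this using 1
      ext x
      simp [smul_add]
    have e1 : ∫ x, (ψ (v j x) + ψ (v (j + 1) x)) ∂μ = Ψ (v j) + Ψ (v (j + 1)) :=
      integral_add (hψi (hvi j)) (hψi (hvi (j + 1)))
    have e2 : ∫ x, g j x ∂μ = (Ψ (v j) + Ψ (v (j + 1)) -
        2 * Ψ (fun x => (1 / 2 : ℝ) • (v j x + v (j + 1) x))) / ((1 / 2) ^ j) ^ 3 +
        (1 / 2) ^ j * (Ψ (v j) + Ψ (v (j + 1))) := by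
      simp only [hg]
      rw [integral_add ((hiD j).div_const _) ((his j).const_mul _), integral_div,
        integral_const_mul, integral_sub (his j) ((hψi (hmi j)).const_mul 2), e1,
        integral_const_mul]
    have h1 := hIle _ _ hmid
    have h2 := hφI j
    have h3 := hvΨ j
    have h4 := hvΨ (j + 1)
    have h5 : ((1 : ℝ) / 16) ^ (j + 1) ≤ (1 / 16) ^ j :=
      pow_le_pow_of_le_one (by norm_num) (by norm_num) (Nat.le_succ j)
    have h6 := hΨB _ (hAS _ (hvA j))
    have h7 := hΨB _ (hAS _ (hvA (j + 1)))
    rw [e2]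
    have h8 : (Ψ (v j) + Ψ (v (j + 1)) -
        2 * Ψ (fun x => (1 / 2 : ℝ) • (v j x + v (j + 1) x))) / ((1 / 2) ^ j) ^ 3 ≤
        4 * (1 / 2) ^ j := by
      rw [div_le_iff₀ (by positivity)]
      have : (4 : ℝ) * (1 / 2) ^ j * ((1 / 2) ^ j) ^ 3 = 4 * (1 / 16) ^ j := by
        rw [show ((1 : ℝ) / 16) = (1 / 2) ^ 4 by norm_num, ← pow_mul, ← pow_mul, mul_assoc,
          ← pow_add]
        congr 2
        ring
      rw [this]
      linarith
    have h9 : (1 / 2 : ℝ) ^ j * (Ψ (v j) + Ψ (v (j + 1))) ≤ (1 / 2) ^ j * (2 * B) := by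
      gcongr; linarith
    linarith
  have hsum := ae_summable_of_summable_integral hgi hg0
    (summable_geometric_two.mul_left (4 + 2 * B)) hgint
  have hconv : ∀ᵐ x ∂μ, ∃ l, Tendsto (fun n => v n x) atTop (𝓝 l) := by
    filter_upwards [hsum] with x hx
    refine cauchySeq_tendsto_of_complete (cauchySeq_of_summable_dist ?_)
    refine Summable.of_norm_bounded_eventually_nat hx ?_
    -- Once `g j x < 1`, the bound `g j x ^ 2` on the increment is below the summable `g j x`.
    filter_upwards [hx.tendsto_atTop_zero.eventually (gt_mem_nhds one_pos)] with j hj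
    rw [Real.norm_of_nonneg dist_nonneg, dist_eq_norm]
    calc ‖v j x - v (j + 1) x‖ ≤ g j x ^ 2 := norm_sub_le_sq_sqrt_defect _ _ (by positivity)
      _ ≤ g j x := by nlinarith [hg0 j x]
  classical
  refine ⟨v, fun x => if h : ∃ l, Tendsto (fun n => v n x) atTop (𝓝 l) then h.choose else 0,
    fun n => hAmono (hφ.id_le n) (hvA n), ?_⟩
  filter_upwards [hconv] with x hx
  rw [dif_pos hx]
  exact hx.choose_spec

end Komlos

/-! ### Convexity and lower semicontinuity of integral functionals; uniform integrability from `L^p`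
bounds. -/

section IntegralFunctionals

open Filter Topology

variable {V : Type*} [NormedAddCommGroup V] {Ω : Type*} [MeasurableSpace Ω] {μ : Measure Ω}

/-- Superposition with a Carathéodory integrand preserves measurability. -/
theorem aemeasurable_superposition {f : Ω → V → ℝ} (hf : ∀ v, AEMeasurable (fun t => f t v) μ)
    (hc : ∀ᵐ t ∂μ, Continuous (f t)) {u : Ω → V} (hu : AEStronglyMeasurable u μ) :
    AEMeasurable (fun t => f t (u t)) μ := by
  classical
  obtain ⟨w, hw, huw⟩ := hu
  have hs : ∀ s : SimpleFunc Ω V, AEMeasurable (fun t => f t (s t)) μ := by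
    intro s
    have e : (fun t => f t (s t)) =
        fun t => ∑ v ∈ s.range, (s ⁻¹' {v}).indicator (fun t => f t v) t := by
      funext t
      rw [Finset.sum_eq_single (s t)]
      · simp
      · intro v _ hv
        exact indicator_of_notMem (fun h => hv (by simpa using h.symm)) _
      · intro h
        exact absurd (s.mem_range_self t) h
    rw [e]
    exact Finset.aemeasurable_fun_sum _ fun v _ => (hf v).indicator (s.measurableSet_fiber v)
  have hfw : AEMeasurable (fun t => f t (w t)) μ := by
    refine aemeasurable_of_tendsto_metrizable_ae atTop (fun n => hs (hw.approx n)) ?_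
    filter_upwards [hc] with t ht
    exact (ht.tendsto _).comp (hw.tendsto_approx t)
  refine hfw.congr ?_
  filter_upwards [huw] with t ht
  rw [ht]

/-- Stated as convexity of a set so that `convexHull_min` carries the bound from a sequence to its
convex combinations. Measurability belongs to the set because it is needed to split the lower
integral. -/
theorem convex_setOf_lintegral_ofReal_le [NormedSpace ℝ V] {g : Ω → V → ℝ}
    (hf : ∀ v, AEMeasurable (fun t => g t v) μ)
    (hc : ∀ᵐ t ∂μ, Continuous (g t) ∧ ConvexOn ℝ univ (g t)) (γ : ℝ≥0∞) :
    Convex ℝ {v : Ω → V | AEStronglyMeasurable v μ ∧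
      ∫⁻ t, ENNReal.ofReal (g t (v t)) ∂μ ≤ γ} := by
  intro v hv w hw a b ha hb hab
  refine ⟨(hv.1.const_smul a).add (hw.1.const_smul b), ?_⟩
  have hm : ∀ {z : Ω → V}, AEStronglyMeasurable z μ →
      AEMeasurable (fun t => ENNReal.ofReal (g t (z t))) μ := fun hz =>
    (aemeasurable_superposition hf (hc.mono fun t ht => ht.1) hz).ennreal_ofReal
  calc ∫⁻ t, ENNReal.ofReal (g t ((a • v + b • w) t)) ∂μ
      ≤ ∫⁻ t, (ENNReal.ofReal a * ENNReal.ofReal (g t (v t)) +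
          ENNReal.ofReal b * ENNReal.ofReal (g t (w t))) ∂μ := by
        refine lintegral_mono_ae ?_
        filter_upwards [hc] with t ht
        rw [← ENNReal.ofReal_mul ha, ← ENNReal.ofReal_mul hb]
        exact (ENNReal.ofReal_le_ofReal (ht.2.2 (mem_univ _) (mem_univ _) ha hb hab)).trans
          ENNReal.ofReal_add_le
    _ = ENNReal.ofReal a * ∫⁻ t, ENNReal.ofReal (g t (v t)) ∂μ +
          ENNReal.ofReal b * ∫⁻ t, ENNReal.ofReal (g t (w t)) ∂μ := by
        rw [lintegral_add_left' ((hm hv.1).const_mul _), lintegral_const_mul'' _ (hm hv.1),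
          lintegral_const_mul'' _ (hm hw.1)]
    _ ≤ ENNReal.ofReal a * γ + ENNReal.ofReal b * γ := by
        gcongr
        exacts [hv.2, hw.2]
    _ = γ := by rw [← add_mul, ← ENNReal.ofReal_add ha hb, hab, ENNReal.ofReal_one, one_mul]

/-- Fatou's lemma combined with continuity of the integrand in its second variable. -/
theorem lintegral_ofReal_le_of_tendsto_ae {g : Ω → V → ℝ}
    (hf : ∀ v, AEMeasurable (fun t => g t v) μ) (hc : ∀ᵐ t ∂μ, Continuous (g t))
    {v : ℕ → Ω → V} {w : Ω → V} (hv : ∀ n, AEStronglyMeasurable (v n) μ)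
    (hlim : ∀ᵐ t ∂μ, Tendsto (fun n => v n t) atTop (𝓝 (w t))) {γ : ℝ≥0∞}
    (hγ : ∀ᶠ n in atTop, ∫⁻ t, ENNReal.ofReal (g t (v n t)) ∂μ ≤ γ) :
    ∫⁻ t, ENNReal.ofReal (g t (w t)) ∂μ ≤ γ := by
  calc ∫⁻ t, ENNReal.ofReal (g t (w t)) ∂μ
      = ∫⁻ t, liminf (fun n => ENNReal.ofReal (g t (v n t))) atTop ∂μ := by
        refine lintegral_congr_ae ?_
        filter_upwards [hlim, hc] with t h1 h2
        exact (ENNReal.tendsto_ofReal ((h2.tendsto _).comp h1)).liminf_eq.symm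
    _ ≤ liminf (fun n => ∫⁻ t, ENNReal.ofReal (g t (v n t)) ∂μ) atTop :=
        lintegral_liminf_le' fun n => (aemeasurable_superposition hf hc (hv n)).ennreal_ofReal
    _ ≤ γ := liminf_le_of_frequently_le' hγ.frequently

/-- As `p > 1`, `ε * r ^ (p - 1) ≥ 1` for large `r`. This is uniform integrability of `L^p`-bounded
families as a pointwise inequality: the first term is bounded, the second is small in mean. -/
theorem exists_le_min_add_mul_rpow {p ε : ℝ} (hp : 1 < p) (hε : 0 < ε) :
    ∃ lam : ℝ, 0 ≤ lam ∧ ∀ r : ℝ, 0 ≤ r → r ≤ min r lam + ε * r ^ p := by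
  have h := (tendsto_rpow_atTop (y := p - 1) (by linarith)).eventually_ge_atTop ε⁻¹
  obtain ⟨lam, h0, hl⟩ := ((eventually_gt_atTop (0 : ℝ)).and
    (eventually_atTop.2 (by
      obtain ⟨a, ha⟩ := eventually_atTop.1 h
      exact ⟨a, fun b hb c (hc : b ≤ c) => ha c (hb.trans hc)⟩))).exists
  refine ⟨lam, h0.le, fun r hr => ?_⟩
  rcases le_total r lam with h1 | h1
  · rw [min_eq_left h1]
    have : 0 ≤ ε * r ^ p := by positivity
    linarith
  · have hr0 : 0 < r := h0.trans_le h1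
    have h2 : r ^ p = r ^ (p - 1) * r := by
      rw [← Real.rpow_add_one hr0.ne']; simp
    have h3 : 1 ≤ ε * r ^ (p - 1) := by
      calc (1 : ℝ) = ε * ε⁻¹ := by field_simp
        _ ≤ _ := mul_le_mul_of_nonneg_left (hl r h1) hε.le
    have h4 : r ≤ ε * r ^ p := by
      rw [h2, ← mul_assoc]; exact le_mul_of_one_le_left hr0.le h3
    have : 0 ≤ min r lam := le_min hr h0.le
    linarith

theorem integrable_of_integrable_norm_rpow [IsFiniteMeasure μ] {p : ℝ} (hp : 1 < p) {v : Ω → V}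
    (hv : AEStronglyMeasurable v μ) (hvp : Integrable (fun t => ‖v t‖ ^ p) μ) :
    Integrable v μ := by
  obtain ⟨lam, -, h⟩ := exists_le_min_add_mul_rpow hp one_pos
  refine ((integrable_const lam).add hvp).mono' hv (Eventually.of_forall fun t => ?_)
  have := h ‖v t‖ (norm_nonneg _)
  have h2 := min_le_right ‖v t‖ lam
  simp only [Pi.add_apply]
  linarith

/-- On short intervals this gives equicontinuity of primitives; on the whole space it gives an `L^1`
bound. -/
theorem setIntegral_norm_le [IsFiniteMeasure μ] {p ε lam K : ℝ} (hp : 1 < p) (hε : 0 < ε)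
    (hlam : ∀ r : ℝ, 0 ≤ r → r ≤ min r lam + ε * r ^ p) {v : Ω → V}
    (hv : AEStronglyMeasurable v μ) (hvp : Integrable (fun t => ‖v t‖ ^ p) μ)
    (hK : ∫ t, ‖v t‖ ^ p ∂μ ≤ K) (s : Set Ω) :
    ∫ t in s, ‖v t‖ ∂μ ≤ lam * μ.real s + ε * K := by
  calc ∫ t in s, ‖v t‖ ∂μ ≤ ∫ t in s, (lam + ε * ‖v t‖ ^ p) ∂μ := by
        refine integral_mono (integrable_of_integrable_norm_rpow hp hv hvp).norm.integrableOn
          ((integrable_const lam).add (hvp.const_mul ε)).integrableOn fun t => ?_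
        have := hlam ‖v t‖ (norm_nonneg _)
        have h2 := min_le_right ‖v t‖ lam
        simp only
        linarith
    _ = lam * μ.real s + ε * ∫ t in s, ‖v t‖ ^ p ∂μ := by
        rw [integral_add (integrable_const lam).integrableOn (hvp.const_mul ε).integrableOn,
          integral_const_mul]
        simp [mul_comm]
    _ ≤ lam * μ.real s + ε * K := by
        gcongr
        exact (setIntegral_le_integral hvp (Eventually.of_forall fun t => by positivity)).trans hK

/-- Almost everywhere convergence and an `Lᵖ` bound, `p > 1`, imply convergence in `L¹`. -/
theorem tendsto_integral_norm_sub_of_integral_norm_rpow_le [IsFiniteMeasure μ] {p K : ℝ}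
    (hp : 1 < p) {v : ℕ → Ω → V} {w : Ω → V} (hv : ∀ n, AEStronglyMeasurable (v n) μ)
    (hw : AEStronglyMeasurable w μ) (hvp : ∀ n, Integrable (fun t => ‖v n t‖ ^ p) μ)
    (hwp : Integrable (fun t => ‖w t‖ ^ p) μ) (hvK : ∀ n, ∫ t, ‖v n t‖ ^ p ∂μ ≤ K)
    (hwK : ∫ t, ‖w t‖ ^ p ∂μ ≤ K)
    (hlim : ∀ᵐ t ∂μ, Tendsto (fun n => v n t) atTop (𝓝 (w t))) :
    Tendsto (fun n => ∫ t, ‖v n t - w t‖ ∂μ) atTop (𝓝 0) := by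
  have hpow : ∀ a b : V, ‖a - b‖ ^ p ≤ 2 ^ p * (‖a‖ ^ p + ‖b‖ ^ p) := by
    intro a b
    have h1 : ‖a - b‖ ≤ 2 * max ‖a‖ ‖b‖ := by
      linarith [norm_sub_le a b, le_max_left ‖a‖ ‖b‖, le_max_right ‖a‖ ‖b‖]
    calc ‖a - b‖ ^ p ≤ (2 * max ‖a‖ ‖b‖) ^ p :=
          Real.rpow_le_rpow (norm_nonneg _) h1 (by linarith)
      _ = 2 ^ p * (max ‖a‖ ‖b‖) ^ p := Real.mul_rpow (by norm_num) (by positivity)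
      _ ≤ _ := by
          gcongr
          rcases max_choice ‖a‖ ‖b‖ with h | h <;> rw [h]
          · have : 0 ≤ ‖b‖ ^ p := by positivity
            linarith
          · have : 0 ≤ ‖a‖ ^ p := by positivity
            linarith
  have hK0 : 0 ≤ K := le_trans (integral_nonneg fun t => by positivity) hwK
  have hint : ∀ n, Integrable (fun t => v n t - w t) μ := fun n =>
    (integrable_of_integrable_norm_rpow hp (hv n) (hvp n)).sub
      (integrable_of_integrable_norm_rpow hp hw hwp)
  have hsum : ∀ n, Integrable (fun t => 2 ^ p * (‖v n t‖ ^ p + ‖w t‖ ^ p)) μ := fun n =>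
    ((hvp n).add hwp).const_mul _
  rw [Metric.tendsto_atTop]
  intro η hη
  set ε : ℝ := η / (2 * (2 ^ p * (2 * K) + 1))
  have hε : 0 < ε := by positivity
  obtain ⟨lam, hlam0, hlam⟩ := exists_le_min_add_mul_rpow hp hε
  have hmeas : ∀ n, AEStronglyMeasurable (fun t => min ‖v n t - w t‖ lam) μ := fun n =>
    (hint n).1.norm.inf aestronglyMeasurable_const
  have hbd : ∀ n, ∀ᵐ t ∂μ, ‖min ‖v n t - w t‖ lam‖ ≤ lam := fun n =>
    Eventually.of_forall fun t => by
      rw [Real.norm_of_nonneg (le_min (norm_nonneg _) hlam0)]; exact min_le_right _ _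
  -- The truncated difference is handled by dominated convergence; the excess costs at most `ε`
  -- times a bound on the `p`-th moments, which the choice of `ε` keeps below `η / 2`.
  have hmin : Tendsto (fun n => ∫ t, min ‖v n t - w t‖ lam ∂μ) atTop (𝓝 0) := by
    have := tendsto_integral_of_dominated_convergence (fun _ => lam) hmeas
      (integrable_const lam) hbd (f := fun _ => (0 : ℝ)) (by
        filter_upwards [hlim] with t ht
        have h1 : Tendsto (fun n => ‖v n t - w t‖) atTop (𝓝 0) := by
          simpa using (ht.sub_const (w t)).norm
        simpa [hlam0] using h1.min (tendsto_const_nhds (x := lam)))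
    simpa using this
  obtain ⟨N, hN⟩ := Metric.tendsto_atTop.1 hmin (η / 2) (by positivity)
  refine ⟨N, fun n hn => ?_⟩
  have h1 := hN n hn
  rw [Real.dist_0_eq_abs] at h1 ⊢
  rw [abs_of_nonneg (integral_nonneg fun t => norm_nonneg _)]
  have hmi : Integrable (fun t => min ‖v n t - w t‖ lam) μ :=
    (integrable_const lam).mono' (hmeas n) (hbd n)
  have h2 : ∫ t, ‖v n t - w t‖ ∂μ ≤
      ∫ t, (min ‖v n t - w t‖ lam + ε * (2 ^ p * (‖v n t‖ ^ p + ‖w t‖ ^ p))) ∂μ := by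
    refine integral_mono (hint n).norm (hmi.add ((hsum n).const_mul ε)) fun t => ?_
    refine (hlam _ (norm_nonneg _)).trans ?_
    gcongr
    exact hpow _ _
  rw [integral_add hmi ((hsum n).const_mul ε), integral_const_mul, integral_const_mul,
    integral_add (hvp n) hwp] at h2
  have h3 : ε * (2 ^ p * (∫ t, ‖v n t‖ ^ p ∂μ + ∫ t, ‖w t‖ ^ p ∂μ)) ≤ ε * (2 ^ p * (2 * K)) := by
    gcongr
    linarith [hvK n]
  have h4 : ε * (2 ^ p * (2 * K)) ≤ η / 2 := by
    have : η / 2 = ε * (2 ^ p * (2 * K) + 1) := by simp only [ε]; field_simp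
    rw [this]
    gcongr
    linarith
  linarith [le_abs_self (∫ t, min ‖v n t - w t‖ lam ∂μ)]

theorem integrable_norm_rpow_of_lintegral_le {p K : ℝ} (hp : 1 < p) (hK : 0 ≤ K) {v : Ω → V}
    (hv : AEStronglyMeasurable v μ)
    (h : ∫⁻ t, ENNReal.ofReal (‖v t‖ ^ p) ∂μ ≤ ENNReal.ofReal K) :
    Integrable (fun t => ‖v t‖ ^ p) μ ∧ ∫ t, ‖v t‖ ^ p ∂μ ≤ K := by
  have hm : AEStronglyMeasurable (fun t => ‖v t‖ ^ p) μ :=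
    (Real.continuous_rpow_const (by linarith : 0 ≤ p)).comp_aestronglyMeasurable hv.norm
  have h0 : 0 ≤ᵐ[μ] fun t => ‖v t‖ ^ p := Eventually.of_forall fun t => by positivity
  refine ⟨⟨hm, ?_⟩, ?_⟩
  · rw [hasFiniteIntegral_iff_ofReal h0]
    exact h.trans_lt ENNReal.ofReal_lt_top
  · rw [integral_eq_lintegral_of_nonneg_ae h0 hm]
    exact ENNReal.toReal_le_of_le_ofReal hK h

end IntegralFunctionals

/-! ### Weak compactness in `L^p` expressed through primitives. -/

section WeakCompactness

open Filter Topology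

variable {V : Type*} [NormedAddCommGroup V] {T : ℝ}

theorem convexOn_norm_rpow [NormedSpace ℝ V] {p : ℝ} (hp : 1 ≤ p) :
    ConvexOn ℝ univ fun v : V => ‖v‖ ^ p := by
  refine ⟨convex_univ, fun x _ y _ a b ha hb hab => ?_⟩
  calc ‖a • x + b • y‖ ^ p ≤ (a • ‖x‖ + b • ‖y‖) ^ p := by
        refine Real.rpow_le_rpow (norm_nonneg _) ((norm_add_le _ _).trans_eq ?_) (by linarith)
        simp [norm_smul, abs_of_nonneg ha, abs_of_nonneg hb]
    _ ≤ a • ‖x‖ ^ p + b • ‖y‖ ^ p :=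
        (convexOn_rpow hp).2 (norm_nonneg x) (norm_nonneg y) ha hb hab

theorem intervalIntegrable_iff_integrable_restrict_Icc (hT : 0 ≤ T) {v : ℝ → V} :
    IntervalIntegrable v volume 0 T ↔ Integrable v (volume.restrict (Icc 0 T)) :=
  intervalIntegrable_iff_integrableOn_Icc_of_le hT

theorem intervalIntegral_eq_setIntegral_restrict_Icc [NormedSpace ℝ V] {v : ℝ → V} {s t : ℝ}
    (hs : 0 ≤ s) (hst : s ≤ t) (ht : t ≤ T) :
    ∫ r in s..t, v r = ∫ r in Ioc s t, v r ∂(volume.restrict (Icc 0 T)) := by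
  rw [intervalIntegral.integral_of_le hst, Measure.restrict_restrict measurableSet_Ioc,
    inter_eq_left.2 (Ioc_subset_Icc_self.trans (Icc_subset_Icc hs ht))]

theorem norm_intervalIntegral_sub_le [NormedSpace ℝ V] (hT : 0 ≤ T) {v w : ℝ → V}
    (hv : Integrable v (volume.restrict (Icc 0 T)))
    (hw : Integrable w (volume.restrict (Icc 0 T))) {t : ℝ} (ht : t ∈ Icc 0 T) :
    ‖(∫ s in 0..t, v s) - ∫ s in 0..t, w s‖ ≤ ∫ s, ‖v s - w s‖ ∂(volume.restrict (Icc 0 T)) := by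
  have iv := ((intervalIntegrable_iff_integrable_restrict_Icc hT).2 hv).mono_right_mem ht
  have iw := ((intervalIntegrable_iff_integrable_restrict_Icc hT).2 hw).mono_right_mem ht
  rw [← intervalIntegral.integral_sub iv iw,
    intervalIntegral_eq_setIntegral_restrict_Icc le_rfl ht.1 ht.2]
  exact (norm_integral_le_integral_norm _).trans
    (setIntegral_le_integral (hv.sub hw).norm (Eventually.of_forall fun _ => norm_nonneg _))

variable [InnerProductSpace ℝ V]

/-- The primitives of a sequence bounded in `Lᵖ`, `p > 1`, are relatively compact for uniform
convergence. -/
theorem exists_subseq_tendsto_primitive [ProperSpace V] (hT : 0 ≤ T) {p K : ℝ} (hp : 1 < p)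
    {u : ℕ → ℝ → V} (hu : ∀ n, AEStronglyMeasurable (u n) (volume.restrict (Icc 0 T)))
    (hup : ∀ n, Integrable (fun t => ‖u n t‖ ^ p) (volume.restrict (Icc 0 T)))
    (huK : ∀ n, ∫ t, ‖u n t‖ ^ p ∂(volume.restrict (Icc 0 T)) ≤ K) :
    ∃ (φ : ℕ → ℕ) (U : ℝ → V), StrictMono φ ∧ ∀ η > 0, ∀ᶠ n in atTop, ∀ t ∈ Icc 0 T,
      ‖(∫ s in 0..t, u (φ n) s) - U t‖ ≤ η := by
  have hK0 : 0 ≤ K := le_trans (integral_nonneg fun t => by positivity) (huK 0)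
  have hi : ∀ n, IntervalIntegrable (u n) volume 0 T := fun n =>
    (intervalIntegrable_iff_integrable_restrict_Icc hT).2
      (integrable_of_integrable_norm_rpow hp (hu n) (hup n))
  -- A modulus of continuity common to all primitives. It yields equicontinuity and, taken at `s =
  -- 0`, the uniform bound required by Arzelà–Ascoli.
  have hmod : ∀ ε > 0, ∃ lam, 0 ≤ lam ∧ ∀ n, ∀ s ∈ Icc 0 T, ∀ t ∈ Icc 0 T,
      ‖(∫ r in 0..t, u n r) - ∫ r in 0..s, u n r‖ ≤ lam * |t - s| + ε * K := by
    intro ε hε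
    obtain ⟨lam, hlam0, hlam⟩ := exists_le_min_add_mul_rpow hp hε
    refine ⟨lam, hlam0, fun n => ?_⟩
    have key : ∀ s ∈ Icc 0 T, ∀ t ∈ Icc 0 T, s ≤ t →
        ‖(∫ r in 0..t, u n r) - ∫ r in 0..s, u n r‖ ≤ lam * |t - s| + ε * K := by
      intro s hs t ht hst
      rw [intervalIntegral.integral_interval_sub_left ((hi n).mono_right_mem ht)
        ((hi n).mono_right_mem hs), intervalIntegral_eq_setIntegral_restrict_Icc hs.1 hst ht.2]
      refine (norm_integral_le_integral_norm _).trans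
        ((setIntegral_norm_le hp hε hlam (hu n) (hup n) (huK n) _).trans ?_)
      gcongr
      rw [measureReal_restrict_apply measurableSet_Ioc,
        inter_eq_left.2 (Ioc_subset_Icc_self.trans (Icc_subset_Icc hs.1 ht.2)),
        Real.volume_real_Ioc_of_le hst]
      exact le_abs_self _
    intro s hs t ht
    rcases le_total s t with h | h
    · exact key s hs t ht h
    · rw [norm_sub_rev, abs_sub_comm]
      exact key t ht s hs h
  let P : ℕ → BoundedContinuousFunction (Icc 0 T) V := fun n =>
    BoundedContinuousFunction.mkOfCompact ⟨fun t => ∫ s in 0..(t : ℝ), u n s,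
      continuousOn_iff_continuous_domRestrict.1 ((hi n).continuousOn_integral hT)⟩
  have hPval : ∀ n t, P n t = ∫ s in 0..(t : ℝ), u n s := fun _ _ => rfl
  obtain ⟨R, hR0, hR⟩ := hmod 1 one_pos
  have hcomp : IsCompact (closure (range P)) := by
    refine BoundedContinuousFunction.arzela_ascoli (Metric.closedBall (0 : V) (R * T + 1 * K))
      (isCompact_closedBall _ _) _ ?_ ?_
    · rintro _ t ⟨n, rfl⟩
      rw [mem_closedBall_zero_iff, hPval]
      have := hR n 0 ⟨le_rfl, hT⟩ t t.2
      simp only [intervalIntegral.integral_same, sub_zero] at this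
      refine this.trans ?_
      gcongr
      rw [abs_of_nonneg t.2.1]
      exact t.2.2
    · refine UniformEquicontinuous.equicontinuous ?_
      rw [Metric.uniformEquicontinuous_iff]
      intro ε hε
      obtain ⟨lam, hlam0, hlam⟩ := hmod (ε / (2 * (K + 1))) (by positivity)
      refine ⟨ε / (2 * (lam + 1)), by positivity, ?_⟩
      rintro s t hst ⟨_, n, rfl⟩
      rw [dist_comm, dist_eq_norm]
      simp only [hPval]
      refine (hlam n s s.2 t t.2).trans_lt ?_
      have h1 : |(t : ℝ) - s| ≤ ε / (2 * (lam + 1)) := by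
        rw [abs_sub_comm]; exact hst.le
      have h2 : lam * |(t : ℝ) - s| ≤ lam * (ε / (2 * (lam + 1))) := by gcongr
      have h3 : lam * (ε / (2 * (lam + 1))) < ε / 2 := by
        rw [mul_div_assoc', div_lt_div_iff₀ (by positivity) (by norm_num)]
        nlinarith
      have h4 : ε / (2 * (K + 1)) * K ≤ ε / 2 := by
        rw [div_mul_eq_mul_div, div_le_div_iff₀ (by positivity) (by norm_num)]
        nlinarith
      linarith
  obtain ⟨U, -, φ, hφ, hlim⟩ := hcomp.tendsto_subseq fun n => subset_closure (mem_range_self n)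
  refine ⟨φ, IccExtend hT U, hφ, fun η hη => ?_⟩
  filter_upwards [(Metric.tendsto_nhds.1 hlim) η hη] with n hn t ht
  rw [IccExtend_of_mem _ _ ht, ← dist_eq_norm]
  exact (BoundedContinuousFunction.dist_coe_le_dist (f := P (φ n)) (g := U) ⟨t, ht⟩).trans hn.le

/-- Weak sequential compactness of bounded sets of `Lᵖ([0,T])`, `p > 1`: along a subsequence the
primitives converge uniformly to the primitive of a function which is the almost everywhere limit of
forward convex combinations. -/
theorem exists_subseq_weak_limit [ProperSpace V] (hT : 0 ≤ T) {p K : ℝ} (hp : 1 < p)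
    {u : ℕ → ℝ → V} (hu : ∀ n, AEStronglyMeasurable (u n) (volume.restrict (Icc 0 T)))
    (hup : ∀ n, Integrable (fun t => ‖u n t‖ ^ p) (volume.restrict (Icc 0 T)))
    (huK : ∀ n, ∫ t, ‖u n t‖ ^ p ∂(volume.restrict (Icc 0 T)) ≤ K) :
    ∃ (φ : ℕ → ℕ) (v : ℕ → ℝ → V) (w : ℝ → V), StrictMono φ ∧
      (∀ n, v n ∈ convexHull ℝ ((fun j => u (φ j)) '' Ici n)) ∧
      AEStronglyMeasurable w (volume.restrict (Icc 0 T)) ∧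
      Integrable (fun t => ‖w t‖ ^ p) (volume.restrict (Icc 0 T)) ∧
      (∀ᵐ t ∂(volume.restrict (Icc 0 T)), Tendsto (fun n => v n t) atTop (𝓝 (w t))) ∧
      ∀ η > 0, ∀ᶠ n in atTop, ∀ t ∈ Icc 0 T,
        ‖(∫ s in 0..t, u (φ n) s) - ∫ s in 0..t, w s‖ ≤ η := by
  set μ := volume.restrict (Icc 0 T)
  have hK0 : 0 ≤ K := le_trans (integral_nonneg fun t => by positivity) (huK 0)
  obtain ⟨φ, U, hφ, hU⟩ := exists_subseq_tendsto_primitive hT hp hu hup huK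
  have hui : ∀ n, Integrable (u n) μ := fun n =>
    integrable_of_integrable_norm_rpow hp (hu n) (hup n)
  obtain ⟨R, -, hR⟩ := exists_le_min_add_mul_rpow hp one_pos
  obtain ⟨v, w, hv, hvw⟩ := exists_mem_convexHull_tendsto_ae (u := fun n => u (φ n))
    (fun n => hui _) (K := R * μ.real univ + 1 * K) fun n => by
      have := setIntegral_norm_le hp one_pos hR (hu (φ n)) (hup (φ n)) (huK (φ n)) univ
      rwa [setIntegral_univ] at this
  have hpm : ∀ z : V, AEMeasurable (fun _ : ℝ => ‖z‖ ^ p) μ := fun z => aemeasurable_const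
  have hpc : ∀ᵐ _ : ℝ ∂μ, Continuous (fun z : V => ‖z‖ ^ p) ∧
      ConvexOn ℝ univ fun z : V => ‖z‖ ^ p := Eventually.of_forall fun _ =>
    ⟨continuous_norm.rpow_const fun _ => Or.inr (by linarith), convexOn_norm_rpow hp.le⟩
  have hvS : ∀ n, AEStronglyMeasurable (v n) μ ∧
      ∫⁻ t, ENNReal.ofReal (‖v n t‖ ^ p) ∂μ ≤ ENNReal.ofReal K := by
    intro n
    refine convexHull_min ?_ (convex_setOf_lintegral_ofReal_le hpm hpc (ENNReal.ofReal K)) (hv n)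
    rintro _ ⟨j, -, rfl⟩
    refine ⟨hu _, ?_⟩
    rw [← ofReal_integral_eq_lintegral_ofReal (hup _)
      (Eventually.of_forall fun t => by positivity)]
    exact ENNReal.ofReal_le_ofReal (huK _)
  have hwm : AEStronglyMeasurable w μ :=
    aestronglyMeasurable_of_tendsto_ae atTop (fun n => (hvS n).1) hvw
  have hwp := integrable_norm_rpow_of_lintegral_le hp hK0 hwm
    (lintegral_ofReal_le_of_tendsto_ae hpm (hpc.mono fun _ h => h.1) (fun n => (hvS n).1) hvw
      (Eventually.of_forall fun n => (hvS n).2))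
  have hvp := fun n => integrable_norm_rpow_of_lintegral_le hp hK0 (hvS n).1 (hvS n).2
  have hwi := integrable_of_integrable_norm_rpow hp hwm hwp.1
  have hvi := fun n => integrable_of_integrable_norm_rpow hp (hvS n).1 (hvp n).1
  have hL1 := tendsto_integral_norm_sub_of_integral_norm_rpow_le hp (fun n => (hvS n).1) hwm
    (fun n => (hvp n).1) hwp.1 (fun n => (hvp n).2) hwp.2 hvw
  refine ⟨φ, v, w, hφ, hv, hwm, hwp.1, hvw, ?_⟩
  -- The primitives of the `v n` have two limits at `t`: the primitive of `w`, by `L^1` convergence,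
  -- and `U t`, because a ball around `U t` is convex and contains the values of the tail.
  have hUw : ∀ t ∈ Icc 0 T, U t = ∫ s in 0..t, w s := by
    intro t ht
    have hlim : Tendsto (fun n => ∫ s in 0..t, v n s) atTop (𝓝 (∫ s in 0..t, w s)) :=
      tendsto_iff_norm_sub_tendsto_zero.2 (squeeze_zero (fun _ => norm_nonneg _)
        (fun n => norm_intervalIntegral_sub_le hT (hvi n) hwi ht) hL1)
    have hlim' : Tendsto (fun n => ∫ s in 0..t, v n s) atTop (𝓝 (U t)) := by
      rw [Metric.tendsto_atTop']
      intro r hr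
      obtain ⟨N, hN⟩ := eventually_atTop.1 (hU (r / 2) (by positivity))
      refine ⟨N, fun n hn => ?_⟩
      have hconv : Convex ℝ {z : ℝ → V | Integrable z μ ∧
          (∫ s in 0..t, z s) ∈ Metric.closedBall (U t) (r / 2)} := by
        intro y hy z hz a b ha hb hab
        have iy := ((intervalIntegrable_iff_integrable_restrict_Icc hT).2 hy.1).mono_right_mem ht
        have iz := ((intervalIntegrable_iff_integrable_restrict_Icc hT).2 hz.1).mono_right_mem ht
        refine ⟨(hy.1.smul a).add (hz.1.smul b), ?_⟩
        have e : ∫ s in 0..t, (a • y + b • z) s =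
            a • (∫ s in 0..t, y s) + b • ∫ s in 0..t, z s := by
          refine (intervalIntegral.integral_add (iy.smul a) (iz.smul b)).trans ?_
          simp only [Pi.smul_apply, intervalIntegral.integral_smul]
        rw [e]
        exact convex_closedBall _ _ hy.2 hz.2 ha hb hab
      have hmem := convexHull_min (t := {z : ℝ → V | Integrable z μ ∧
          (∫ s in 0..t, z s) ∈ Metric.closedBall (U t) (r / 2)}) (by
        rintro _ ⟨j, hj, rfl⟩
        refine ⟨hui _, ?_⟩
        rw [mem_closedBall_iff_norm]
        exact hN j (hn.le.trans hj) t ht) hconv (hv n)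
      exact lt_of_le_of_lt hmem.2 (by linarith)
    exact tendsto_nhds_unique hlim' hlim
  intro η hη
  filter_upwards [hU η hη] with n hn t ht
  rw [← hUw t ht]
  exact hn t ht

end WeakCompactness

/-! ### Testing weakly small functions against absolutely continuous ones. -/

section IntegrationByParts

theorem EuclideanSpace.norm_le_sum_abs {d : ℕ} (x : E d) : ‖x‖ ≤ ∑ j, |x j| := by
  rw [EuclideanSpace.norm_eq]
  refine Real.sqrt_le_iff.2 ⟨Finset.sum_nonneg fun j _ => abs_nonneg _, ?_⟩
  simp only [Real.norm_eq_abs]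
  exact Finset.sum_sq_le_sq_sum_of_nonneg fun j _ => abs_nonneg _

variable {T : ℝ}

/-- Integration by parts moves the derivative from the primitive of `w` onto `g`. The constant is a
bound for `|g|` plus the integral of `|g'|`, so it does not depend on `w`. -/
theorem AbsolutelyContinuousOnInterval.exists_abs_integral_mul_le {g : ℝ → ℝ} (hT : 0 ≤ T)
    (hg : AbsolutelyContinuousOnInterval g 0 T) :
    ∃ C : ℝ, 0 ≤ C ∧ ∀ (w : ℝ → ℝ) (η : ℝ), IntervalIntegrable w volume 0 T →
      (∀ t ∈ Icc 0 T, |∫ s in 0..t, w s| ≤ η) →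
      ∀ t ∈ Icc 0 T, |∫ s in 0..t, w s * g s| ≤ C * η := by
  obtain ⟨B, hB⟩ := hg.exists_bound
  rw [uIcc_of_le hT] at hB
  have hB0 : 0 ≤ B := (norm_nonneg _).trans (hB 0 ⟨le_rfl, hT⟩)
  have hD := hg.intervalIntegrable_deriv
  have hD0 : 0 ≤ ∫ s in 0..T, |deriv g s| :=
    intervalIntegral.integral_nonneg hT fun s _ => abs_nonneg _
  refine ⟨B + ∫ s in 0..T, |deriv g s|, by positivity, fun w η hw hη t ht => ?_⟩
  have hη0 : 0 ≤ η := (abs_nonneg _).trans (hη 0 ⟨le_rfl, hT⟩)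
  have hwt := hw.mono_right_mem ht
  have hsub : uIcc 0 t ⊆ uIcc 0 T := uIcc_subset_uIcc_left (by rwa [uIcc_of_le hT])
  have hW := hwt.absolutelyContinuousOnInterval_integral
  have hparts := (hg.mono hsub).integral_mul_deriv_eq_deriv_mul hW
  have e : ∫ s in 0..t, w s * g s = ∫ s in 0..t, g s * deriv (fun r => ∫ v in 0..r, w v) s := by
    refine intervalIntegral.integral_congr_ae ?_
    filter_upwards [hwt.ae_hasDerivAt_integral] with s hs hs'
    rw [(hs (uIoc_subset_uIcc hs') 0 left_mem_uIcc).deriv, mul_comm]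
  rw [e, hparts]
  have h1 : |g t * ∫ v in 0..t, w v| ≤ B * η := by
    rw [abs_mul]
    exact mul_le_mul (hB t ht) (hη t ht) (abs_nonneg _) hB0
  have h2 : |∫ s in 0..t, deriv g s * ∫ v in 0..s, w v| ≤ (∫ s in 0..T, |deriv g s|) * η := by
    calc |∫ s in 0..t, deriv g s * ∫ v in 0..s, w v| ≤ ∫ s in 0..t, |deriv g s| * η := by
          rw [← Real.norm_eq_abs]
          refine intervalIntegral.norm_integral_le_of_norm_le ht.1
            (Filter.Eventually.of_forall fun s hs => ?_) ((hD.mono_set hsub).abs.mul_const η)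
          rw [norm_mul]
          exact mul_le_mul_of_nonneg_left (hη s ⟨hs.1.le, hs.2.trans ht.2⟩) (norm_nonneg _)
      _ = (∫ s in 0..t, |deriv g s|) * η := intervalIntegral.integral_mul_const _ _
      _ ≤ _ := mul_le_mul_of_nonneg_right
          (integral_nonneg_mono_of_nonneg hD.abs (fun _ => abs_nonneg _) ht).2 hη0
  simp only [intervalIntegral.integral_same, mul_zero, sub_zero]
  calc _ ≤ |g t * ∫ v in 0..t, w v| + |∫ s in 0..t, deriv g s * ∫ v in 0..s, w v| := abs_sub _ _
    _ ≤ _ := by rw [add_mul]; exact add_le_add h1 h2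

theorem AbsolutelyContinuousOnInterval.exists_norm_integral_smul_le {d : ℕ} {g : ℝ → E d}
    (hT : 0 ≤ T) (hg : AbsolutelyContinuousOnInterval g 0 T) :
    ∃ C : ℝ, 0 ≤ C ∧ ∀ (w : ℝ → ℝ) (η : ℝ), IntervalIntegrable w volume 0 T →
      (∀ t ∈ Icc 0 T, |∫ s in 0..t, w s| ≤ η) →
      ∀ t ∈ Icc 0 T, ‖∫ s in 0..t, w s • g s‖ ≤ C * η := by
  have hj : ∀ j : Fin d, AbsolutelyContinuousOnInterval (fun t => g t j) 0 T := fun j =>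
    (EuclideanSpace.proj (𝕜 := ℝ) j : E d →L[ℝ] ℝ).lipschitz.comp_absolutelyContinuousOnInterval hg
  choose C hC0 hC using fun j => (hj j).exists_abs_integral_mul_le hT
  refine ⟨∑ j, C j, Finset.sum_nonneg fun j _ => hC0 j, fun w η hw hη t ht => ?_⟩
  have hi : IntervalIntegrable (fun s => w s • g s) volume 0 t :=
    (hw.smul_continuousOn hg.continuousOn).mono_right_mem ht
  refine (EuclideanSpace.norm_le_sum_abs _).trans ?_
  rw [Finset.sum_mul]
  refine Finset.sum_le_sum fun j _ => ?_
  have e := (EuclideanSpace.proj (𝕜 := ℝ) j : E d →L[ℝ] ℝ).intervalIntegral_comp_comm hi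
  refine (congrArg abs e.symm).trans_le ?_
  exact hC j w η hw hη t ht

end IntegrationByParts

/-! ### Existence, uniqueness and continuous dependence for the control system. -/

section ControlSystem

open Filter Topology

variable {d k l : ℕ} {Θ : Set (E l)} {T L : ℝ}

/-- The Lipschitz-type condition on the drift and on the controlled fields. -/
def IsLipschitzFamily (L : ℝ) (F₀ : E d → Θ → E d) (F : Fin k → E d → Θ → E d) : Prop :=
  0 < L ∧ ∀ (x₁ x₂ : E d) (θ₁ θ₂ : Θ),
    ‖F₀ x₁ θ₁ - F₀ x₂ θ₂‖ ≤
      L * (‖x₁ - x₂‖ + ‖x₁ + x₂‖ * ‖(θ₁ : E l) - (θ₂ : E l)‖) ∧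
    ∀ i : Fin k, ‖F i x₁ θ₁ - F i x₂ θ₂‖ ≤
      L * (‖x₁ - x₂‖ + ‖x₁ + x₂‖ * ‖(θ₁ : E l) - (θ₂ : E l)‖)

/-- The right-hand side of the control system. -/
def controlField (F₀ : E d → Θ → E d) (F : Fin k → E d → Θ → E d) (u : ℝ → E k) (θ : Θ)
    (s : ℝ) (x : E d) : E d :=
  F₀ x θ + ∑ i, u s i • F i x θ

/-- A Lipschitz constant of `controlField` at time `s`. -/
def controlRate (L : ℝ) (u : ℝ → E k) (s : ℝ) : ℝ := L * (1 + ∑ i, |u s i|)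

theorem controlRate_nonneg (hL : 0 < L) (u : ℝ → E k) (s : ℝ) : 0 ≤ controlRate L u s :=
  mul_nonneg hL.le (add_nonneg zero_le_one (Finset.sum_nonneg fun _ _ => abs_nonneg _))

theorem controlRate_le (hL : 0 < L) (u : ℝ → E k) (s : ℝ) :
    controlRate L u s ≤ L * (1 + k * ‖u s‖) := by
  refine mul_le_mul_of_nonneg_left (add_le_add_right ?_ _) hL.le
  calc ∑ i, |u s i| ≤ ∑ _i : Fin k, ‖u s‖ :=
        Finset.sum_le_sum fun i _ => PiLp.norm_apply_le (u s) i
    _ = k * ‖u s‖ := by simp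

theorem intervalIntegrable_apply {u : ℝ → E k} (hu : IntervalIntegrable u volume 0 T) (i : Fin k) :
    IntervalIntegrable (fun s => u s i) volume 0 T :=
  ⟨(EuclideanSpace.proj (𝕜 := ℝ) i : E k →L[ℝ] ℝ).integrable_comp hu.1,
    (EuclideanSpace.proj (𝕜 := ℝ) i : E k →L[ℝ] ℝ).integrable_comp hu.2⟩

theorem intervalIntegral_apply {u : ℝ → E k} {a b : ℝ} (hu : IntervalIntegrable u volume a b)
    (i : Fin k) : ∫ s in a..b, u s i = (∫ s in a..b, u s) i :=
  (EuclideanSpace.proj (𝕜 := ℝ) i : E k →L[ℝ] ℝ).intervalIntegral_comp_comm hu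

theorem intervalIntegrable_sum_fin {V : Type*} [NormedAddCommGroup V] {g : Fin k → ℝ → V}
    (hg : ∀ i, IntervalIntegrable (g i) volume 0 T) :
    IntervalIntegrable (fun s => ∑ i, g i s) volume 0 T := by
  have := IntervalIntegrable.sum (f := g) Finset.univ fun i _ => hg i
  convert! this using 1
  ext s
  simp

theorem intervalIntegrable_controlRate {u : ℝ → E k} (hu : IntervalIntegrable u volume 0 T) :
    IntervalIntegrable (controlRate L u) volume 0 T :=
  (intervalIntegrable_const.add
    (intervalIntegrable_sum_fin fun i => (intervalIntegrable_apply hu i).abs)).const_mul L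

variable {F₀ : E d → Θ → E d} {F : Fin k → E d → Θ → E d}

theorem IsLipschitzFamily.norm_controlField_sub_le (hF : IsLipschitzFamily L F₀ F) (u : ℝ → E k)
    (s : ℝ) (x₁ x₂ : E d) (θ₁ θ₂ : Θ) :
    ‖controlField F₀ F u θ₁ s x₁ - controlField F₀ F u θ₂ s x₂‖ ≤
      controlRate L u s * (‖x₁ - x₂‖ + ‖x₁ + x₂‖ * ‖(θ₁ : E l) - (θ₂ : E l)‖) := by
  obtain ⟨h0, h1⟩ := hF.2 x₁ x₂ θ₁ θ₂
  set R := ‖x₁ - x₂‖ + ‖x₁ + x₂‖ * ‖(θ₁ : E l) - (θ₂ : E l)‖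
  have e : controlField F₀ F u θ₁ s x₁ - controlField F₀ F u θ₂ s x₂ =
      (F₀ x₁ θ₁ - F₀ x₂ θ₂) + ∑ i, u s i • (F i x₁ θ₁ - F i x₂ θ₂) := by
    simp only [controlField, smul_sub, Finset.sum_sub_distrib]
    abel
  rw [e]
  calc _ ≤ ‖F₀ x₁ θ₁ - F₀ x₂ θ₂‖ + ∑ i, ‖u s i • (F i x₁ θ₁ - F i x₂ θ₂)‖ :=
        (norm_add_le _ _).trans (add_le_add_right (norm_sum_le _ _) _)
    _ ≤ L * R + ∑ i, |u s i| * (L * R) := by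
        refine add_le_add h0 (Finset.sum_le_sum fun i _ => ?_)
        rw [norm_smul, Real.norm_eq_abs]
        exact mul_le_mul_of_nonneg_left (h1 i) (abs_nonneg _)
    _ = controlRate L u s * R := by
        rw [← Finset.sum_mul, controlRate]; ring

theorem IsLipschitzFamily.norm_controlField_sub_le_same (hF : IsLipschitzFamily L F₀ F)
    (u : ℝ → E k) (θ : Θ) (s : ℝ) (x₁ x₂ : E d) :
    ‖controlField F₀ F u θ s x₁ - controlField F₀ F u θ s x₂‖ ≤
      controlRate L u s * ‖x₁ - x₂‖ := by
  simpa using hF.norm_controlField_sub_le u s x₁ x₂ θ θ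

theorem IsLipschitzFamily.lipschitzWith (hF : IsLipschitzFamily L F₀ F) (θ : Θ) :
    LipschitzWith L.toNNReal (fun x => F₀ x θ) ∧
      ∀ i, LipschitzWith L.toNNReal (fun x => F i x θ) := by
  refine ⟨LipschitzWith.of_dist_le' fun x y => ?_, fun i => LipschitzWith.of_dist_le' fun x y => ?_⟩
  · simpa [dist_eq_norm] using (hF.2 x y θ θ).1
  · simpa [dist_eq_norm] using (hF.2 x y θ θ).2 i

theorem IsLipschitzFamily.intervalIntegrable_controlField (hF : IsLipschitzFamily L F₀ F)
    (hT : 0 ≤ T) {u : ℝ → E k} (hu : IntervalIntegrable u volume 0 T) (θ : Θ) (z : ℝ → E d)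
    (hz : ContinuousOn z (Icc 0 T)) :
    IntervalIntegrable (fun s => controlField F₀ F u θ s (z s)) volume 0 T := by
  rw [← uIcc_of_le hT] at hz
  obtain ⟨h0, h1⟩ := hF.lipschitzWith θ
  exact (h0.continuous.comp_continuousOn hz).intervalIntegrable.add
    (intervalIntegrable_sum_fin fun i =>
      (intervalIntegrable_apply hu i).smul_continuousOn ((h1 i).continuous.comp_continuousOn hz))

variable {x₀ : Θ → E d}

/-- The fundamental theorem of calculus in both directions; it makes the integral-equation estimates
available for trajectories. -/
theorem isTrajectory_iff (hF : IsLipschitzFamily L F₀ F) (hT : 0 ≤ T) {u : ℝ → E k}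
    (hu : IntervalIntegrable u volume 0 T) (θ : Θ) (x : ℝ → E d) :
    IsTrajectory T F₀ F x₀ u θ x ↔ ContinuousOn x (Icc 0 T) ∧
      ∀ t ∈ Icc 0 T, x t = x₀ θ + ∫ s in 0..t, controlField F₀ F u θ s (x s) := by
  constructor
  · intro h
    have hc : ContinuousOn x (Icc 0 T) := by
      have := h.absolutelyContinuous.continuousOn
      rwa [uIcc_of_le hT] at this
    refine ⟨hc, fun t ht => ?_⟩
    rw [← h.initial]
    refine h.absolutelyContinuous.eq_add_integral
      (hF.intervalIntegrable_controlField hT hu θ x hc) ?_ t (by rwa [uIcc_of_le hT])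
    rw [uIcc_of_le hT]
    exact (ae_restrict_iff' measurableSet_Icc).1 h.ode
  · rintro ⟨hc, hx⟩
    have hi := hF.intervalIntegrable_controlField hT hu θ x hc
    refine ⟨?_, ?_, ?_⟩
    · refine hi.absolutelyContinuousOnInterval_integral.of_dist_le (C := 1) fun s hs t ht => ?_
      rw [uIcc_of_le hT] at hs ht
      rw [hx s hs, hx t ht, dist_add_left, one_mul]
    · simpa using hx 0 ⟨le_rfl, hT⟩
    -- The integral equation says nothing outside `[0,T]`, so two-sided derivatives are computed at
    -- interior points only; the end points form a null set.
    · rw [← Measure.restrict_congr_set Ioo_ae_eq_Icc, ae_restrict_iff' measurableSet_Ioo]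
      filter_upwards [hi.ae_hasDerivAt_integral] with t h ht
      have hd := (h (by rw [uIcc_of_le hT]; exact Ioo_subset_Icc_self ht) 0
        left_mem_uIcc).const_add (x₀ θ)
      refine hd.congr_of_eventuallyEq ?_
      filter_upwards [Ioo_mem_nhds ht.1 ht.2] with s hs
      exact hx s (Ioo_subset_Icc_self hs)

theorem IsLipschitzFamily.isTrajectory_evolution (hF : IsLipschitzFamily L F₀ F) (hT : 0 ≤ T)
    {u : ℝ → E k} (hu : IntervalIntegrable u volume 0 T) (θ : Θ) :
    IsTrajectory T F₀ F x₀ u θ (fun t => evolution T F₀ F x₀ u t θ) := by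
  obtain ⟨x, hx⟩ := exists_continuousOn_eq_add_integral hT (intervalIntegrable_controlRate hu)
    (controlRate_nonneg hF.1 u) (hF.norm_controlField_sub_le_same u θ)
    (hF.intervalIntegrable_controlField hT hu θ) (x₀ θ)
  exact Classical.epsilon_spec (p := fun x : ℝ → E d => IsTrajectory T F₀ F x₀ u θ x)
    ⟨x, (isTrajectory_iff hF hT hu θ x).2 hx⟩

theorem IsTrajectory.eqOn (hF : IsLipschitzFamily L F₀ F) (hT : 0 ≤ T)
    {u : ℝ → E k} (hu : IntervalIntegrable u volume 0 T) {θ : Θ} {x y : ℝ → E d}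
    (hx : IsTrajectory T F₀ F x₀ u θ x) (hy : IsTrajectory T F₀ F x₀ u θ y) :
    EqOn x y (Icc 0 T) := by
  rw [isTrajectory_iff hF hT hu] at hx hy
  intro t ht
  have := norm_sub_le_of_integral_eq (A := 0) hT (intervalIntegrable_controlRate hu)
    (controlRate_nonneg hF.1 u) (hF.norm_controlField_sub_le_same u θ)
    (hF.intervalIntegrable_controlField hT hu θ)
    (hF.intervalIntegrable_controlField hT hu θ y hy.1) hx.1 hy.1 hx.2 hy.2 (by simp) t ht
  rw [zero_mul] at this
  exact sub_eq_zero.1 (norm_le_zero_iff.1 this)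

/-- Both fields are compared along the trajectory of the fixed parameter `θ₂`. It is bounded by some
`B`, so the factor `‖x₁ + x₂‖` becomes at most `2 * B`, uniformly in `θ₁`. -/
theorem IsLipschitzFamily.continuous_evolution (hF : IsLipschitzFamily L F₀ F) (hT : 0 ≤ T)
    {u : ℝ → E k} (hu : IntervalIntegrable u volume 0 T) (hx₀ : Continuous x₀) {t : ℝ}
    (ht : t ∈ Icc 0 T) : Continuous fun θ => evolution T F₀ F x₀ u t θ := by
  have hm := intervalIntegrable_controlRate (L := L) hu
  have hm0 := controlRate_nonneg hF.1 u
  have hsol := fun θ => (isTrajectory_iff hF hT hu θ _).1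
    (hF.isTrajectory_evolution hT hu (x₀ := x₀) θ)
  rw [continuous_iff_continuousAt]
  intro θ₂
  obtain ⟨B, hB⟩ := isCompact_Icc.exists_bound_of_continuousOn (hsol θ₂).1
  set M := ∫ s in 0..T, controlRate L u s
  have key : ∀ θ₁ : Θ, ‖evolution T F₀ F x₀ u t θ₁ - evolution T F₀ F x₀ u t θ₂‖ ≤
      (‖x₀ θ₁ - x₀ θ₂‖ + M * (2 * B * ‖(θ₁ : E l) - (θ₂ : E l)‖)) *
        Real.exp (∫ s in 0..t, controlRate L u s) := by
    intro θ₁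
    have hB0 : 0 ≤ 2 * B * ‖(θ₁ : E l) - (θ₂ : E l)‖ :=
      mul_nonneg (mul_nonneg zero_le_two ((norm_nonneg _).trans (hB t ht))) (norm_nonneg _)
    refine norm_sub_le_of_integral_eq hT hm hm0 (hF.norm_controlField_sub_le_same u θ₁)
      (hF.intervalIntegrable_controlField hT hu θ₁)
      (hF.intervalIntegrable_controlField hT hu θ₂ _ (hsol θ₂).1)
      (hsol θ₁).1 (hsol θ₂).1 (hsol θ₁).2 (hsol θ₂).2 (fun r hr => ?_) t ht
    refine (norm_add_le _ _).trans (add_le_add_right ?_ _)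
    calc _ ≤ ∫ s in 0..r, controlRate L u s * (2 * B * ‖(θ₁ : E l) - (θ₂ : E l)‖) := by
          refine intervalIntegral.norm_integral_le_of_norm_le hr.1
            (Eventually.of_forall fun s hs => (hF.norm_controlField_sub_le u s _ _ θ₁ θ₂).trans ?_)
            ((hm.mono_right_mem hr).mul_const _)
          refine mul_le_mul_of_nonneg_left ?_ (hm0 s)
          rw [sub_self, norm_zero, zero_add, ← two_smul ℝ, norm_smul, Real.norm_two]
          gcongr
          exact hB s ⟨hs.1.le, hs.2.trans hr.2⟩
      _ = (∫ s in 0..r, controlRate L u s) * (2 * B * ‖(θ₁ : E l) - (θ₂ : E l)‖) :=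
          intervalIntegral.integral_mul_const _ _
      _ ≤ _ := mul_le_mul_of_nonneg_right (integral_nonneg_mono_of_nonneg hm hm0 hr).2 hB0
  rw [ContinuousAt, tendsto_iff_norm_sub_tendsto_zero]
  refine squeeze_zero (fun _ => norm_nonneg _) key ?_
  have : Continuous fun θ₁ : Θ => (‖x₀ θ₁ - x₀ θ₂‖ + M * (2 * B * ‖(θ₁ : E l) - (θ₂ : E l)‖)) *
        Real.exp (∫ s in 0..t, controlRate L u s) := by fun_prop
  simpa using this.tendsto θ₂

/-- Continuity of the evolution for the convergence of controls in the sense of uniform convergence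
of their primitives. -/
theorem IsLipschitzFamily.tendsto_evolution (hF : IsLipschitzFamily L F₀ F) (hT : 0 ≤ T)
    {u : ℕ → ℝ → E k} {w : ℝ → E k} (hu : ∀ n, IntervalIntegrable (u n) volume 0 T)
    (hw : IntervalIntegrable w volume 0 T) {M : ℝ}
    (hM : ∀ n, ∫ s in 0..T, controlRate L (u n) s ≤ M)
    (hlim : ∀ η > 0, ∀ᶠ n in atTop, ∀ t ∈ Icc 0 T,
      ‖(∫ s in 0..t, u n s) - ∫ s in 0..t, w s‖ ≤ η) (θ : Θ) :
    Tendsto (fun n => evolution T F₀ F x₀ (u n) T θ) atTop (𝓝 (evolution T F₀ F x₀ w T θ)) := by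
  have htraj := hF.isTrajectory_evolution hT hw (x₀ := x₀) θ
  have hy := (isTrajectory_iff hF hT hw θ _).1 htraj
  set y : ℝ → E d := fun t => evolution T F₀ F x₀ w t θ with hydef
  -- The fields are evaluated along the limit trajectory, which is fixed, so the constants `C i`
  -- obtained from them do not depend on `n`.
  have hg : ∀ i, AbsolutelyContinuousOnInterval (fun t => F i (y t) θ) 0 T := fun i =>
    ((hF.lipschitzWith θ).2 i).comp_absolutelyContinuousOnInterval htraj.absolutelyContinuous
  choose C hC0 hC using fun i => (hg i).exists_norm_integral_smul_le hT
  set S := ∑ i, C i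
  have hS : 0 ≤ S := Finset.sum_nonneg fun i _ => hC0 i
  have key : ∀ η > 0, ∀ᶠ n in atTop,
      ‖evolution T F₀ F x₀ (u n) T θ - y T‖ ≤ S * η * Real.exp M := by
    intro η hη
    filter_upwards [hlim η hη] with n hn
    have hx := (isTrajectory_iff hF hT (hu n) θ _).1
      (hF.isTrajectory_evolution hT (hu n) (x₀ := x₀) θ)
    refine (norm_sub_le_of_integral_eq (A := S * η) hT (intervalIntegrable_controlRate (hu n))
      (controlRate_nonneg hF.1 (u n)) (hF.norm_controlField_sub_le_same (u n) θ)
      (hF.intervalIntegrable_controlField hT (hu n) θ)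
      (hF.intervalIntegrable_controlField hT hw θ y hy.1) hx.1 hy.1 hx.2 hy.2
      (fun t ht => ?_) T ⟨hT, le_rfl⟩).trans ?_
    · have e : ∀ s, controlField F₀ F (u n) θ s (y s) - controlField F₀ F w θ s (y s) =
          ∑ i, (u n s i - w s i) • F i (y s) θ := by
        intro s
        simp only [controlField, sub_smul, Finset.sum_sub_distrib]
        abel
      have hwi : ∀ i, IntervalIntegrable (fun s => u n s i - w s i) volume 0 T := fun i =>
        (intervalIntegrable_apply (hu n) i).sub (intervalIntegrable_apply hw i)
      simp only [e, sub_self, zero_add]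
      rw [intervalIntegral.integral_finsetSum fun i _ =>
        ((hwi i).smul_continuousOn (hg i).continuousOn).mono_right_mem ht]
      refine (norm_sum_le _ _).trans ?_
      rw [Finset.sum_mul]
      refine Finset.sum_le_sum fun i _ => hC i _ η (hwi i) (fun r hr => ?_) t ht
      have h1 := (hu n).mono_right_mem hr
      have h2 := hw.mono_right_mem hr
      rw [intervalIntegral.integral_sub ((intervalIntegrable_apply (hu n) i).mono_right_mem hr)
        ((intervalIntegrable_apply hw i).mono_right_mem hr), intervalIntegral_apply h1,
        intervalIntegral_apply h2]
      exact (PiLp.norm_apply_le ((∫ s in 0..r, u n s) - ∫ s in 0..r, w s) i).trans (hn r hr)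
    · gcongr
      exact hM n
  rw [Metric.tendsto_nhds]
  intro ε hε
  filter_upwards [key (ε / (2 * (S * Real.exp M + 1))) (by positivity)] with n hn
  rw [dist_eq_norm]
  refine hn.trans_lt ?_
  have h : S * (ε / (2 * (S * Real.exp M + 1))) * Real.exp M =
      ε * (S * Real.exp M) / (2 * (S * Real.exp M + 1)) := by ring
  rw [h, div_lt_iff₀ (by positivity)]
  nlinarith [mul_nonneg hS (Real.exp_pos M).le]

end ControlSystem

/-! ### The direct method for a nonnegative running cost. -/

section Minimisation

open Filter Topology

variable {d k l : ℕ} {Θ : Set (E l)} {T p L : ℝ}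

theorem controlSpace_intervalIntegrable (hT : 0 ≤ T) (hp : 1 < p) (u : ControlSpace T p k) :
    IntervalIntegrable u volume 0 T :=
  (intervalIntegrable_iff_integrable_restrict_Icc hT).2
    ((Lp.memLp u).integrable (by rw [← ENNReal.ofReal_one]; exact ENNReal.ofReal_le_ofReal hp.le))

variable {F₀ : E d → Θ → E d} {F : Fin k → E d → Θ → E d} {x₀ : Θ → E d}

theorem IsLipschitzFamily.exists_max_terminal_cost [CompactSpace Θ] [Nonempty Θ]
    (hF : IsLipschitzFamily L F₀ F) (hT : 0 ≤ T) {a : E d → Θ → ℝ}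
    (ha : Continuous (fun q : E d × Θ => a q.1 q.2)) (hx₀ : Continuous x₀) {u : ℝ → E k}
    (hu : IntervalIntegrable u volume 0 T) :
    ∃ θ' : Θ, ∀ θ : Θ,
      a (evolution T F₀ F x₀ u T θ) θ ≤ a (evolution T F₀ F x₀ u T θ') θ' := by
  have hc : Continuous fun θ => a (evolution T F₀ F x₀ u T θ) θ :=
    ha.comp ((hF.continuous_evolution hT hu hx₀ ⟨hT, le_rfl⟩).prodMk continuous_id)
  obtain ⟨θ', -, h⟩ := isCompact_univ.exists_isMaxOn univ_nonempty hc.continuousOn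
  exact ⟨θ', fun θ => h (mem_univ θ)⟩

theorem integral_controlRate_le (hL : 0 < L) (hT : 0 ≤ T) {u : ℝ → E k}
    (hu : IntervalIntegrable u volume 0 T) {K : ℝ}
    (hK : ∫ s, ‖u s‖ ∂(volume.restrict (Icc 0 T)) ≤ K) :
    ∫ s in 0..T, controlRate L u s ≤ L * (T + k * K) := by
  have hK' : ∫ s in 0..T, ‖u s‖ ≤ K := by
    refine le_trans (le_of_eq ?_) hK
    rw [intervalIntegral.integral_of_le hT, integral_Icc_eq_integral_Ioc]
  calc ∫ s in 0..T, controlRate L u s ≤ ∫ s in 0..T, L * (1 + k * ‖u s‖) :=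
        intervalIntegral.integral_mono_on hT (intervalIntegrable_controlRate hu)
          ((intervalIntegrable_const.add (hu.norm.const_mul _)).const_mul _)
          fun s _ => controlRate_le hL u s
    _ = L * (T + k * ∫ s in 0..T, ‖u s‖) := by
        rw [intervalIntegral.integral_const_mul, intervalIntegral.integral_add
          intervalIntegrable_const (hu.norm.const_mul _), intervalIntegral.integral_const_mul]
        simp
    _ ≤ _ := by gcongr

/-- The minimax cost for a nonnegative running cost. -/
noncomputable def nonnegCost (F₀ : E d → Θ → E d) (F : Fin k → E d → Θ → E d) (x₀ : Θ → E d)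
    (a : E d → Θ → ℝ) (g : ℝ → E k → ℝ) (u : ControlSpace T p k) : ℝ≥0∞ :=
  (⨆ θ : Θ, ENNReal.ofReal (a (evolution T F₀ F x₀ u T θ) θ)) +
    ∫⁻ t in Icc (0 : ℝ) T, ENNReal.ofReal (g t (u t))

theorem IsLipschitzFamily.exists_minimizer [Nonempty Θ] (hF : IsLipschitzFamily L F₀ F)
    (hT : 0 ≤ T) (hp : 1 < p) {a : E d → Θ → ℝ}
    (ha : Continuous (fun q : E d × Θ => a q.1 q.2)) {g : ℝ → E k → ℝ}
    (hg_meas : ∀ v : E k, AEMeasurable (fun t => g t v) (volume.restrict (Icc (0 : ℝ) T)))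
    (hg_conv : ∀ᵐ t ∂(volume.restrict (Icc (0 : ℝ) T)),
      Continuous (g t) ∧ ConvexOn ℝ Set.univ (g t))
    {C : ℝ} (hC : 0 < C)
    (hg : ∀ᵐ t ∂(volume.restrict (Icc (0 : ℝ) T)), ∀ v : E k, C * ‖v‖ ^ p ≤ g t v)
    (hfin : ∃ u : ControlSpace T p k, nonnegCost F₀ F x₀ a g u ≠ ⊤) :
    ∃ u' : ControlSpace T p k, ∀ u : ControlSpace T p k,
      nonnegCost F₀ F x₀ a g u' ≤ nonnegCost F₀ F x₀ a g u := by
  set μ := volume.restrict (Icc (0 : ℝ) T)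
  set J : ControlSpace T p k → ℝ≥0∞ := nonnegCost F₀ F x₀ a g
  set G : (ℝ → E k) → ℝ≥0∞ := fun v => ∫⁻ t, ENNReal.ofReal (g t (v t)) ∂μ
  set m := ⨅ u, J u
  have hm : m ≠ ⊤ := by
    obtain ⟨u, hu⟩ := hfin
    exact ne_top_of_le_ne_top hu (iInf_le _ u)
  have hseq : ∀ n : ℕ, ∃ u, J u < m + ((n + 1 : ℕ) : ℝ≥0∞)⁻¹ := fun n =>
    iInf_lt_iff.1 (ENNReal.lt_add_right hm (by simp))
  choose u hu using hseq
  have hGu : ∀ n, G (u n) ≤ m + 1 := by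
    intro n
    refine (le_add_self.trans (hu n).le).trans (add_le_add_right ?_ m)
    rw [ENNReal.inv_le_one]
    exact_mod_cast Nat.le_add_left 1 n
  set K := (ENNReal.ofReal C⁻¹ * (m + 1)).toReal
  have hKt : ENNReal.ofReal K = ENNReal.ofReal C⁻¹ * (m + 1) :=
    ENNReal.ofReal_toReal (ENNReal.mul_ne_top ENNReal.ofReal_ne_top
      (ENNReal.add_ne_top.2 ⟨hm, ENNReal.one_ne_top⟩))
  have hum : ∀ n, AEStronglyMeasurable (u n) μ := fun n => (Lp.memLp (u n)).1
  have hub : ∀ n, ∫⁻ t, ENNReal.ofReal (‖u n t‖ ^ p) ∂μ ≤ ENNReal.ofReal K := by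
    intro n
    calc ∫⁻ t, ENNReal.ofReal (‖u n t‖ ^ p) ∂μ
        ≤ ∫⁻ t, ENNReal.ofReal C⁻¹ * ENNReal.ofReal (g t (u n t)) ∂μ := by
          refine lintegral_mono_ae ?_
          filter_upwards [hg] with t ht
          rw [← ENNReal.ofReal_mul (by positivity)]
          refine ENNReal.ofReal_le_ofReal ?_
          rw [← div_eq_inv_mul, le_div_iff₀ hC, mul_comm]
          exact ht _
      _ = ENNReal.ofReal C⁻¹ * G (u n) := lintegral_const_mul' _ _ ENNReal.ofReal_ne_top
      _ ≤ _ := by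
          rw [hKt]
          exact mul_le_mul_right (hGu n) _
  have hup := fun n => integrable_norm_rpow_of_lintegral_le hp ENNReal.toReal_nonneg (hum n) (hub n)
  -- Compactness of `[0,∞]` makes the running costs converge before the weak limit is extracted, so
  -- the two terms of the cost can be passed to the limit separately.
  obtain ⟨γ, φ₁, hφ₁, hγ⟩ := CompactSpace.tendsto_subseq fun n => G (u n)
  obtain ⟨φ₂, v, w, hφ₂, hv, hwm, hwp, hvw, hlim⟩ := exists_subseq_weak_limit hT hp
    (u := fun n => u (φ₁ n)) (fun n => hum _) (fun n => (hup _).1) (fun n => (hup _).2)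
  have hφ : Tendsto (fun n => φ₁ (φ₂ n)) atTop atTop :=
    hφ₁.tendsto_atTop.comp hφ₂.tendsto_atTop
  have hγ' : Tendsto (fun n => G (u (φ₁ (φ₂ n)))) atTop (𝓝 γ) := hγ.comp hφ₂.tendsto_atTop
  have hGw : G w ≤ γ := by
    -- For each `δ > γ` a tail of the sequence lies in the convex sublevel set at `δ`, hence so do
    -- the forward convex combinations, and Fatou's lemma passes to `w`.
    refine le_of_forall_gt_imp_ge_of_dense fun δ hδ => ?_
    obtain ⟨N, hN⟩ := eventually_atTop.1 (hγ'.eventually (ge_mem_nhds hδ))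
    have hmem : ∀ n, N ≤ n → G (v n) ≤ δ := fun n hn =>
      (convexHull_min (by
        rintro _ ⟨j, hj, rfl⟩
        exact ⟨hum _, hN j (hn.trans hj)⟩)
        (convex_setOf_lintegral_ofReal_le hg_meas hg_conv δ) (hv n)).2
    refine lintegral_ofReal_le_of_tendsto_ae hg_meas (hg_conv.mono fun _ h => h.1) (fun n => ?_)
      hvw (eventually_atTop.2 ⟨N, hmem⟩)
    -- The trivial level `⊤` is used to extract measurability of every `v n`.
    exact (convexHull_min (by
      rintro _ ⟨j, hj, rfl⟩
      exact ⟨hum _, le_top⟩) (convex_setOf_lintegral_ofReal_le hg_meas hg_conv ⊤) (hv n)).1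
  have hp0 : ENNReal.ofReal p ≠ 0 := by
    rw [ne_eq, ENNReal.ofReal_eq_zero]; linarith
  have hwL : MemLp w (ENNReal.ofReal p) μ := by
    rw [← integrable_norm_rpow_iff hwm hp0 ENNReal.ofReal_ne_top,
      ENNReal.toReal_ofReal (by linarith)]
    exact hwp
  set u' : ControlSpace T p k := hwL.toLp w
  have hu'w : u' =ᵐ[μ] w := hwL.coeFn_toLp
  have hGu' : G u' ≤ γ := by
    refine le_trans (le_of_eq (lintegral_congr_ae ?_)) hGw
    filter_upwards [hu'w] with t ht
    rw [ht]
  have hii := controlSpace_intervalIntegrable (k := k) hT hp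
  obtain ⟨R, -, hR⟩ := exists_le_min_add_mul_rpow hp one_pos
  have hconv : ∀ θ : Θ, Tendsto (fun n => evolution T F₀ F x₀ (u (φ₁ (φ₂ n))) T θ) atTop
      (𝓝 (evolution T F₀ F x₀ u' T θ)) := by
    refine hF.tendsto_evolution hT (fun n => hii _) (hii _)
      (M := L * (T + k * (R * μ.real univ + 1 * K)))
      (fun n => integral_controlRate_le hF.1 hT (hii _) ?_) fun η hη => ?_
    · have := setIntegral_norm_le hp one_pos hR (hum (φ₁ (φ₂ n))) (hup _).1 (hup _).2 univ
      rwa [setIntegral_univ] at this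
    · filter_upwards [hlim η hη] with n hn t ht
      have e : ∫ s in 0..t, u' s = ∫ s in 0..t, w s := by
        refine intervalIntegral.integral_congr_ae ?_
        filter_upwards [(ae_restrict_iff' measurableSet_Icc).1 hu'w] with s hs hst
        rw [uIoc_of_le ht.1] at hst
        exact hs ⟨hst.1.le, hst.2.trans ht.2⟩
      rw [e]
      exact hn t ht
  refine ⟨u', fun z => le_trans ?_ (iInf_le _ z)⟩
  change (⨆ θ : Θ, ENNReal.ofReal (a (evolution T F₀ F x₀ u' T θ) θ)) + G u' ≤ m
  -- Pulling the supremum outside lets each `θ` be treated alone, so pointwise convergence of the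
  -- end points is enough.
  rw [ENNReal.iSup_add]
  refine iSup_le fun θ => le_trans (add_le_add_right hGu' _) ?_
  have h1 : Tendsto (fun n => ENNReal.ofReal (a (evolution T F₀ F x₀ (u (φ₁ (φ₂ n))) T θ) θ) +
      G (u (φ₁ (φ₂ n)))) atTop
      (𝓝 (ENNReal.ofReal (a (evolution T F₀ F x₀ u' T θ) θ) + γ)) := by
    refine (ENNReal.tendsto_ofReal ?_).add hγ'
    exact (ha.tendsto (evolution T F₀ F x₀ u' T θ, θ)).comp ((hconv θ).prodMk_nhds
      (tendsto_const_nhds (x := θ)))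
  have h2 : Tendsto (fun n => m + ((φ₁ (φ₂ n) + 1 : ℕ) : ℝ≥0∞)⁻¹) atTop (𝓝 (m + 0)) :=
    tendsto_const_nhds.add ((ENNReal.tendsto_inv_nat_nhds_zero.comp
      (tendsto_add_atTop_nat 1)).comp hφ)
  rw [add_zero] at h2
  refine le_of_tendsto_of_tendsto' h1 h2 fun n => le_trans ?_ (hu _).le
  exact add_le_add_left (le_iSup (fun θ : Θ =>
    ENNReal.ofReal (a (evolution T F₀ F x₀ (u (φ₁ (φ₂ n))) T θ) θ)) θ) _

end Minimisation

/-! ### Shifting the extended integral by an integrable function. -/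

section ExtendedIntegral

/-- Since `N` and `c` are finite, `P` and `G` are infinite together; otherwise the identity is one
of real numbers. -/
theorem EReal.coe_ennreal_sub_eq_of_add_eq_add {P N G c : ℝ≥0∞} (h : P + c = G + N) (hN : N ≠ ⊤)
    (hc : c ≠ ⊤) : (P : EReal) - N = (G : EReal) - c := by
  by_cases hP : P = ⊤
  · have hG : G = ⊤ := by
      by_contra hG
      rw [hP, top_add] at h
      exact ENNReal.add_ne_top.2 ⟨hG, hN⟩ h.symm
    rw [hP, hG, ← EReal.coe_ennreal_toReal hN, ← EReal.coe_ennreal_toReal hc]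
    simp
  · have hG : G ≠ ⊤ := by
      rintro rfl
      rw [top_add] at h
      exact ENNReal.add_ne_top.2 ⟨hP, hc⟩ h
    have h' := congrArg ENNReal.toReal h
    rw [ENNReal.toReal_add hP hc, ENNReal.toReal_add hG hN] at h'
    rw [← EReal.coe_ennreal_toReal hP, ← EReal.coe_ennreal_toReal hN,
      ← EReal.coe_ennreal_toReal hG, ← EReal.coe_ennreal_toReal hc, ← EReal.coe_sub,
      ← EReal.coe_sub]
    congr 1
    linarith

/-- The integral of a function bounded below by `-c` in terms of the nonnegative function
`g + c`. -/
theorem extIntegral_eq_sub {T : ℝ} {g c : ℝ → ℝ}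
    (hg : AEMeasurable g (volume.restrict (Icc (0 : ℝ) T)))
    (hc : IntegrableOn c (Icc (0 : ℝ) T))
    (hc0 : ∀ᵐ t ∂(volume.restrict (Icc (0 : ℝ) T)), 0 ≤ c t)
    (hgc : ∀ᵐ t ∂(volume.restrict (Icc (0 : ℝ) T)), 0 ≤ g t + c t) :
    (∫⁻ t in Icc (0 : ℝ) T, ENNReal.ofReal (-g t)) ≠ ⊤ ∧
    extIntegral T g = ((∫⁻ t in Icc (0 : ℝ) T, ENNReal.ofReal (g t + c t) : ℝ≥0∞) : EReal) -
      ((∫⁻ t in Icc (0 : ℝ) T, ENNReal.ofReal (c t) : ℝ≥0∞) : EReal) := by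
  have hct : (∫⁻ t in Icc (0 : ℝ) T, ENNReal.ofReal (c t)) ≠ ⊤ :=
    (hasFiniteIntegral_iff_ofReal hc0).1 hc.2 |>.ne
  have hN : (∫⁻ t in Icc (0 : ℝ) T, ENNReal.ofReal (-g t)) ≠ ⊤ := by
    refine ne_top_of_le_ne_top hct (lintegral_mono_ae ?_)
    filter_upwards [hgc] with t ht
    exact ENNReal.ofReal_le_ofReal (by linarith)
  refine ⟨hN, EReal.coe_ennreal_sub_eq_of_add_eq_add ?_ hN hct⟩
  have hgcm : AEMeasurable (fun t => g t + c t) (volume.restrict (Icc (0 : ℝ) T)) :=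
    hg.add hc.1.aemeasurable
  -- What remains is the pointwise identity `g⁺ + c = (g + c) + g⁻`, valid as `c` and `g + c` are
  -- nonnegative.
  rw [← lintegral_add_left' hg.ennreal_ofReal, ← lintegral_add_left' hgcm.ennreal_ofReal]
  refine lintegral_congr_ae ?_
  filter_upwards [hc0, hgc] with t h1 h2
  rcases le_total 0 (g t) with h | h
  · rw [ENNReal.ofReal_of_nonpos (by linarith : -g t ≤ 0), add_zero, ENNReal.ofReal_add h h1]
  · rw [ENNReal.ofReal_of_nonpos h, zero_add, ← ENNReal.ofReal_add h2 (by linarith)]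
    congr 1
    ring

end ExtendedIntegral

/-! ### Reduction to a nonnegative running cost. -/

theorem mainTheorem1 {d k l : ℕ} (Θ : Set (E l)) (hΘ : IsCompact Θ) (hΘne : Θ.Nonempty)
    (T p : ℝ) (hT : 0 < T) (hp : 1 < p)
    (F₀ : E d → Θ → E d) (F : Fin k → E d → Θ → E d) (x₀ : Θ → E d)
    (a : E d → Θ → ℝ) (f : ℝ → E k → ℝ)
    -- Lipschitz dynamics
    (hF : ∃ L : ℝ, 0 < L ∧ ∀ (x₁ x₂ : E d) (θ₁ θ₂ : Θ),
      ‖F₀ x₁ θ₁ - F₀ x₂ θ₂‖ ≤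
        L * (‖x₁ - x₂‖ + ‖x₁ + x₂‖ * ‖(θ₁ : E l) - (θ₂ : E l)‖) ∧
      ∀ i : Fin k, ‖F i x₁ θ₁ - F i x₂ θ₂‖ ≤
        L * (‖x₁ - x₂‖ + ‖x₁ + x₂‖ * ‖(θ₁ : E l) - (θ₂ : E l)‖))
    -- initial data
    (hx₀ : Continuous x₀)
    -- terminal cost
    (ha : Continuous (fun q : E d × Θ => a q.1 q.2))
    (ha_nonneg : ∀ x θ, 0 ≤ a x θ)
    -- running cost
    (hf_meas : ∀ v : E k, AEMeasurable (fun t => f t v) (volume.restrict (Icc (0 : ℝ) T)))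
    (hf_conv : ∀ᵐ t ∂(volume.restrict (Icc (0 : ℝ) T)),
      Continuous (f t) ∧ ConvexOn ℝ Set.univ (f t))
    (hf_growth : ∃ (c : ℝ → ℝ) (C : ℝ), IntegrableOn c (Icc (0 : ℝ) T) ∧
      (∀ᵐ t ∂(volume.restrict (Icc (0 : ℝ) T)), 0 ≤ c t) ∧ 0 < C ∧
      ∀ᵐ t ∂(volume.restrict (Icc (0 : ℝ) T)), ∀ v : E k, C * ‖v‖ ^ p - c t ≤ f t v)
    (hf_point : ∃ (v' : E k) (c' : ℝ → ℝ), IntegrableOn c' (Icc (0 : ℝ) T) ∧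
      ∀ᵐ t ∂(volume.restrict (Icc (0 : ℝ) T)), |f t v'| ≤ c' t) :
    -- the functional is well defined: the trajectories exist and are unique on `[0,T]`,
    -- the maximum over `Θ` is attained, and the integral of the running cost makes sense
    -- in `(-∞,∞]`
    (∀ u : ControlSpace T p k,
      (∀ θ : Θ, IsTrajectory T F₀ F x₀ u θ (fun t => evolution T F₀ F x₀ u t θ) ∧
        ∀ y : ℝ → E d, IsTrajectory T F₀ F x₀ u θ y →
          EqOn y (fun t => evolution T F₀ F x₀ u t θ) (Icc (0 : ℝ) T)) ∧
      (∃ θ' : Θ, ∀ θ : Θ,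
        a (evolution T F₀ F x₀ u T θ) θ ≤ a (evolution T F₀ F x₀ u T θ') θ') ∧
      AEMeasurable (fun t => f t (u t)) (volume.restrict (Icc (0 : ℝ) T)) ∧
      (∫⁻ t in Icc (0 : ℝ) T, ENNReal.ofReal (-f t (u t))) ≠ ⊤) ∧
    -- the minimum is attained, and it is finite
    ∃ u' : ControlSpace T p k,
      minimaxCost T F₀ F x₀ a f u' = ⨅ u : ControlSpace T p k, minimaxCost T F₀ F x₀ a f u ∧
      minimaxCost T F₀ F x₀ a f u' ≠ ⊥ ∧ minimaxCost T F₀ F x₀ a f u' ≠ ⊤ := by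
  have hT0 := hT.le
  have : CompactSpace Θ := isCompact_iff_compactSpace.1 hΘ
  have : Nonempty Θ := hΘne.to_subtype
  obtain ⟨L, hF⟩ := hF
  replace hF : IsLipschitzFamily L F₀ F := hF
  obtain ⟨c, C, hc, hc0, hC, hgrowth⟩ := hf_growth
  obtain ⟨v', c', hc', hfv'⟩ := hf_point
  have hii := controlSpace_intervalIntegrable (k := k) hT0 hp
  have hmax := fun u : ControlSpace T p k => hF.exists_max_terminal_cost hT0 ha hx₀ (hii u)
  have hfm : ∀ u : ControlSpace T p k,
      AEMeasurable (fun t => f t (u t)) (volume.restrict (Icc (0 : ℝ) T)) := fun u =>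
    aemeasurable_superposition hf_meas (hf_conv.mono fun _ h => h.1) (Lp.memLp u).1
  set g : ℝ → E k → ℝ := fun t v => f t v + c t with hgdef
  have hg : ∀ᵐ t ∂(volume.restrict (Icc (0 : ℝ) T)), ∀ v : E k, C * ‖v‖ ^ p ≤ g t v := by
    filter_upwards [hgrowth] with t ht v
    linarith [ht v]
  have hext := fun u : ControlSpace T p k => extIntegral_eq_sub (hfm u) hc hc0 (by
    filter_upwards [hg] with t ht
    exact le_trans (by positivity) (ht (u t)))
  refine ⟨fun u => ⟨fun θ => ⟨hF.isTrajectory_evolution hT0 (hii u) θ, fun y hy =>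
    hy.eqOn hF hT0 (hii u) (hF.isTrajectory_evolution hT0 (hii u) θ)⟩, hmax u, hfm u,
    (hext u).1⟩, ?_⟩
  -- Because the maximum is attained and `a` is nonnegative, the suprema in `ℝ≥0∞` and in `EReal`
  -- are the same finite number.
  have hsup : ∀ u : ControlSpace T p k, ∃ A : ℝ≥0∞, A ≠ ⊤ ∧
      (⨆ θ : Θ, ENNReal.ofReal (a (evolution T F₀ F x₀ u T θ) θ)) = A ∧
      (⨆ θ : Θ, ((a (evolution T F₀ F x₀ u T θ) θ : ℝ) : EReal)) = (A : EReal) := by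
    intro u
    obtain ⟨θ', hθ'⟩ := hmax u
    refine ⟨ENNReal.ofReal (a (evolution T F₀ F x₀ u T θ') θ'), ENNReal.ofReal_ne_top, ?_, ?_⟩
    · exact le_antisymm (iSup_le fun θ => ENNReal.ofReal_le_ofReal (hθ' θ))
        (le_iSup (fun θ : Θ => ENNReal.ofReal (a (evolution T F₀ F x₀ u T θ) θ)) θ')
    · rw [EReal.coe_ennreal_ofReal, max_eq_left (ha_nonneg _ _)]
      exact le_antisymm (iSup_le fun θ => EReal.coe_le_coe_iff.2 (hθ' θ))
        (le_iSup (fun θ : Θ => ((a (evolution T F₀ F x₀ u T θ) θ : ℝ) : EReal)) θ')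
  set cbar : ℝ≥0∞ := ∫⁻ t in Icc (0 : ℝ) T, ENNReal.ofReal (c t)
  have hcbar : cbar ≠ ⊤ := ((hasFiniteIntegral_iff_ofReal hc0).1 hc.2).ne
  have hcost : ∀ u : ControlSpace T p k, minimaxCost T F₀ F x₀ a f u =
      (nonnegCost F₀ F x₀ a g u : EReal) - cbar := by
    intro u
    obtain ⟨A, -, h1, h2⟩ := hsup u
    rw [minimaxCost, nonnegCost, h1, h2, (hext u).2, EReal.coe_ennreal_add, sub_eq_add_neg,
      sub_eq_add_neg, add_assoc]
  -- The constant control `v'` has finite cost: its running cost is at most `c' + c`.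
  have hfin : ∃ u : ControlSpace T p k, nonnegCost F₀ F x₀ a g u ≠ ⊤ := by
    have hL : MemLp (fun _ : ℝ => v') (ENNReal.ofReal p) (volume.restrict (Icc (0 : ℝ) T)) :=
      memLp_const v'
    refine ⟨hL.toLp _, ?_⟩
    obtain ⟨A, hA, h1, -⟩ := hsup (hL.toLp _)
    rw [nonnegCost, h1]
    refine ENNReal.add_ne_top.2 ⟨hA, ?_⟩
    have hlt : (∫⁻ t in Icc (0 : ℝ) T, ‖c' t + c t‖ₑ) < ⊤ := (hc'.add hc).2
    refine ne_top_of_le_ne_top hlt.ne (lintegral_mono_ae ?_)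
    filter_upwards [hL.coeFn_toLp, hfv'] with t ht h2
    rw [ht, ← ofReal_norm]
    exact ENNReal.ofReal_le_ofReal (le_trans (add_le_add_left ((le_abs_self _).trans h2) _)
      (le_abs_self _))
  obtain ⟨u', hu'⟩ := hF.exists_minimizer (x₀ := x₀) hT0 hp ha (g := g)
    (fun v => (hf_meas v).add hc.1.aemeasurable)
    (hf_conv.mono fun t ht => ⟨ht.1.add continuous_const, ht.2.add_const _⟩) hC hg hfin
  have hu'fin : nonnegCost F₀ F x₀ a g u' ≠ ⊤ := by
    obtain ⟨u, hu⟩ := hfin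
    exact ne_top_of_le_ne_top hu (hu' u)
  refine ⟨u', le_antisymm (le_iInf fun u => ?_) (iInf_le _ u'), ?_⟩
  · rw [hcost, hcost]
    exact EReal.sub_le_sub (EReal.coe_ennreal_le_coe_ennreal_iff.2 (hu' u)) le_rfl
  · rw [hcost, ← EReal.coe_ennreal_toReal hu'fin, ← EReal.coe_ennreal_toReal hcbar,
      ← EReal.coe_sub]
    exact ⟨EReal.coe_ne_bot _, EReal.coe_ne_top _⟩
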